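/- Let $G=(V,E)$ be a finite simple graph with $n$ nodes and $m\ge 1$ edges, and let $\lambda\in[0,1]$. For $U\subseteq V$ let $E(U)$ be the set of edges with both endpoints in $U$. The wedge graph $Z(H)$ of a graph $H$ has as nodes the edges of $H$ that lie in some wedge, where a wedge is a triple $(x,y,z)$ of distinct vertices such that $xy$ and $yz$ are edges of $H$ and $xz$ is not; two nodes are adjacent in $Z(H)$ if the two edges form a wedge. A matching $M$ of $Z((U,E(U)))$ defines a labeling $L$ of $E(U)$: an edge is weak if it is an endpoint of an element of $M$, and strong otherwise. Write $\deg_s(v,U,L)$ and $\deg_w(v,U,L)$ for the number of strong and weak edges of $E(U)$ at $v$, $m_s(U,L)$ and $m_w(U,L)$ for the number of strong and weak edges in $E(U)$, and $q(U,L)=(m_s(U,L)+\lambda m_w(U,L))/|U|$ for $U\neq\emptyset$. The algorithm $\textsc{Greedy}(G,\lambda)$ is the following. Start with $U=V$ and a matching $M$ of $Z(G)$ obtained by adding edges of $Z(G)$ with both endpoints unmatched, until there are none. While $U\ne\emptyset$: choose $u\in U$ that minimizes $\deg_s(u,U,L)+\lambda\deg_w(u,U,L)$; let $N(u)$ be the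 set of edges of $E(U)$ at $u$; remove $u$ from $U$, replace the wedge graph by $Z((U,E(U)))$, and update $M$ as follows: for each $a\in N(u)$ in turn, if $(a,b)\in M$ for some $b$, delete $(a,b)$ from $M$, and if $b\notin N(u)$ and there is $t\notin N(u)$ that is not an endpoint of any element of $M$ and is adjacent to $b$ in the wedge graph, add $(b,t)$ to $M$ for one such $t$. Then update $L$ and the weighted degrees. Finally return a pair $(U,L)$ with the largest $q(U,L)$ among those with $U\neq\emptyset$ that occurred. Let $n'$ and $m'$ be the numbers of nodes and edges of $Z(G)$. Then, throughout the algorithm, $M$ is a maximal matching of $Z((U,E(U)))$, and $\textsc{Greedy}$, given $G$ as a list of edges, can be implemented on a real RAM (unit-cost arithmetic and comparisons on $O(\log n)$-bit words and on real numbers), with the wedge graph, the matching and the weighted degrees of the remaining nodes maintained in memory, so that its running time is in \[ O\bigl(mn+(n'+m')+m\log n+nm\bigr)\subseteq O(nm), \] with constants that do not depend on $G$ and $\lambda$. -/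

import Mathlib

/-! ## Graphs, wedge graphs, labelings and scores -/

namespace STC

/-- The graph `(U, E(U))`, kept on the vertex type `V`. -/
def restrict {V : Type*} (G : SimpleGraph V) (U : Finset V) : SimpleGraph V where
  Adj x y := G.Adj x y ∧ x ∈ U ∧ y ∈ U
  symm := ⟨fun _ _ h => ⟨h.1.symm, h.2.2, h.2.1⟩⟩
  loopless := ⟨fun _ h => G.irrefl h.1⟩

/-- `(x, y, z)` is a wedge: `xy` and `yz` are edges and `xz` is not. -/
def IsWedge {V : Type*} (G : SimpleGraph V) (x y z : V) : Prop :=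
  G.Adj x y ∧ G.Adj y z ∧ x ≠ z ∧ ¬ G.Adj x z

/-- Adjacency of the wedge graph `Z(G)`: two edges of `G` that form a wedge. It is a graph on the
type `Sym2 V`; the nodes of `Z(G)` proper are those in its support, see `wedgeNodes`. -/
def wedgeGraph {V : Type*} (G : SimpleGraph V) : SimpleGraph (Sym2 V) where
  Adj e f := ∃ x y z, IsWedge G x y z ∧ e = s(x, y) ∧ f = s(y, z)
  symm := ⟨by
    rintro e f ⟨x, y, z, ⟨h1, h2, h3, h4⟩, rfl, rfl⟩
    exact ⟨z, y, x, ⟨h2.symm, h1.symm, h3.symm, fun h => h4 h.symm⟩, Sym2.eq_swap, Sym2.eq_swap⟩⟩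
  loopless := ⟨by
    rintro e ⟨x, y, z, ⟨h1, h2, h3, h4⟩, he, hf⟩
    rw [he, Sym2.eq_iff] at hf
    rcases hf with ⟨h, _⟩ | ⟨h, _⟩
    · exact G.irrefl (h ▸ h1)
    · exact h3 h⟩

/-- The nodes of `Z(G)`: the edges of `G` that contribute to at least one wedge. -/
def wedgeNodes {V : Type*} (G : SimpleGraph V) : Set (Sym2 V) :=
  {e | ∃ f, (wedgeGraph G).Adj e f}

/-- `a` is an endpoint of an edge in `M`. -/
def Covered {α : Type*} (M : Set (Sym2 α)) (a : α) : Prop := ∃ p ∈ M, a ∈ p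

/-- `M` is a maximal matching of the graph `Z`. -/
def IsMaximalMatching {α : Type*} (Z : SimpleGraph α) (M : Set (Sym2 α)) : Prop :=
  M ⊆ Z.edgeSet ∧
  (∀ p ∈ M, ∀ q ∈ M, ∀ a, a ∈ p → a ∈ q → p = q) ∧
  (∀ a b, Z.Adj a b → Covered M a ∨ Covered M b)

/-- A labeling is given by its set `L` of weak edges; the other edges are strong. -/
noncomputable def mStrong {V : Type*} (G : SimpleGraph V) (U : Finset V)
    (L : Set (Sym2 V)) : ℕ := ((restrict G U).edgeSet \ L).ncard

noncomputable def mWeak {V : Type*} (G : SimpleGraph V) (U : Finset V)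
    (L : Set (Sym2 V)) : ℕ := ((restrict G U).edgeSet ∩ L).ncard

/-- `(m_s(U, L) + lam * m_w(U, L)) / |U|`. -/
noncomputable def score {V : Type*} (G : SimpleGraph V) (lam : ℝ) (U : Finset V)
    (L : Set (Sym2 V)) : ℝ :=
  ((mStrong G U L : ℝ) + lam * (mWeak G U L : ℝ)) / (U.card : ℝ)

/-- The weighted degree `deg_s(v, U, L) + lam * deg_w(v, U, L)`. -/
noncomputable def weightedDegree {V : Type*} (G : SimpleGraph V) (lam : ℝ) (U : Finset V)
    (L : Set (Sym2 V)) (v : V) : ℝ :=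
  (((restrict G U).incidenceSet v \ L).ncard : ℝ) +
    lam * (((restrict G U).incidenceSet v ∩ L).ncard : ℝ)

/-- The labeling given by a matching `M` of the wedge graph: the endpoints of the edges in `M`
(a vertex cover, if `M` is maximal) are weak, all other edges are strong. -/
def weakEdges {V : Type*} (M : Set (Sym2 (Sym2 V))) : Set (Sym2 V) := {e | Covered M e}

/-! ## The algorithm Greedy

The pseudocode leaves choices open (the edge picked for the matching, the order of `N(v)`, the node
`t`, ties in the minimum), so that each procedure is a relation. -/

/-- The sets `M` that the matching procedure can reach: starting from the empty set, pick an edge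
of `Z` none of whose endpoints is covered so far, and add it. -/
inductive AprReach {α : Type*} (Z : SimpleGraph α) : Set (Sym2 α) → Prop
  | empty : AprReach Z ∅
  | pick (M : Set (Sym2 α)) (a b : α) : AprReach Z M → Z.Adj a b → ¬ Covered M a →
      ¬ Covered M b → AprReach Z (insert s(a, b) M)

/-- A possible result of the matching procedure, which stops when no edge is left to pick. -/
def AprMatching {α : Type*} (Z : SimpleGraph α) (M : Set (Sym2 α)) : Prop :=
  AprReach Z M ∧ ¬ ∃ a b, Z.Adj a b ∧ ¬ Covered M a ∧ ¬ Covered M b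

/-- `(b, t)` can replace a deleted edge `(a, b)`; here `N` is the set of deleted nodes. -/
def IsReplacement {α : Type*} (Z : SimpleGraph α) (N : Set α) (M : Set (Sym2 α))
    (b t : α) : Prop :=
  b ∉ N ∧ t ∉ N ∧ ¬ Covered M t ∧ Z.Adj b t

/-- The pass of the loop of Dynamic-Vertex-Cover for the node `a`, turning `M` into `M'`. -/
inductive DynStep {α : Type*} (Z : SimpleGraph α) (N : Set α) (a : α) (M : Set (Sym2 α)) :
    Set (Sym2 α) → Prop
  | unmatched : (¬ ∃ b, s(a, b) ∈ M) → DynStep Z N a M M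
  | replace (b t : α) : s(a, b) ∈ M → IsReplacement Z N (M \ {s(a, b)}) b t →
      DynStep Z N a M (insert s(b, t) (M \ {s(a, b)}))
  | drop (b : α) : s(a, b) ∈ M → (¬ ∃ t, IsReplacement Z N (M \ {s(a, b)}) b t) →
      DynStep Z N a M (M \ {s(a, b)})

/-- The loop of Dynamic-Vertex-Cover over a list of nodes. -/
inductive DynLoop {α : Type*} (Z : SimpleGraph α) (N : Set α) :
    List α → Set (Sym2 α) → Set (Sym2 α) → Prop
  | nil (M : Set (Sym2 α)) : DynLoop Z N [] M M
  | cons (a : α) (l : List α) (M M' M'' : Set (Sym2 α)) : DynStep Z N a M M' →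
      DynLoop Z N l M' M'' → DynLoop Z N (a :: l) M M''

/-- Dynamic-Vertex-Cover: the nodes in `N` are deleted, `Z` is the graph after the deletion, and
`M'` is a possible result for the matching `M`. -/
def DynamicVertexCover {α : Type*} (Z : SimpleGraph α) (N : Set α) (M M' : Set (Sym2 α)) : Prop :=
  ∃ l : List α, l.Nodup ∧ (∀ a, a ∈ l ↔ a ∈ N) ∧ DynLoop Z N l M M'

/-- A run of Greedy: `U i` and `M i` are the vertex set and the matching of the wedge graph
after `i` iterations, and `u i` is the vertex deleted next. -/
structure GreedyRun {V : Type*} [Fintype V] [DecidableEq V] (G : SimpleGraph V) (lam : ℝ)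
    (U : ℕ → Finset V) (M : ℕ → Set (Sym2 (Sym2 V))) (u : ℕ → V) : Prop where
  start_vertices : U 0 = Finset.univ
  start_matching : AprMatching (wedgeGraph G) (M 0)
  mem : ∀ i < Fintype.card V, u i ∈ U i
  argmin : ∀ i < Fintype.card V, ∀ v ∈ U i,
    weightedDegree G lam (U i) (weakEdges (M i)) (u i) ≤
      weightedDegree G lam (U i) (weakEdges (M i)) v
  delete : ∀ i < Fintype.card V, U (i + 1) = (U i).erase (u i)
  relabel : ∀ i < Fintype.card V, DynamicVertexCover (wedgeGraph (restrict G (U (i + 1))))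
    ((restrict G (U i)).incidenceSet (u i)) (M i) (M (i + 1))

end STC

/-! ## The machine model: a real RAM

Programs have access to finitely many arrays of machine words and finitely many arrays of real
numbers (a scalar variable is a cell of an array). The words are natural numbers below a bound
`W`, which is taken polynomial in the size of the input, that is, words have `O(log n)` bits.
Arithmetic and comparisons on words and on reals take unit time; reals cannot be rounded or
converted to words. -/

namespace RAM

structure State where
  ints : ℕ → ℕ → ℕ
  reals : ℕ → ℕ → ℝ

/-- Word expressions; `get a i` is the cell `i` of the array `a`. -/
inductive IExp
  | const (k : ℕ)
  | get (a : ℕ) (i : IExp)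
  | add (e f : IExp)
  | sub (e f : IExp)
  | mul (e f : IExp)
  | div (e f : IExp)

/-- Real expressions. -/
inductive RExp
  | ofInt (e : IExp)
  | get (a : ℕ) (i : IExp)
  | add (e f : RExp)
  | sub (e f : RExp)
  | mul (e f : RExp)

/-- Tests. -/
inductive BExp
  | ilt (e f : IExp)
  | ieq (e f : IExp)
  | rlt (e f : RExp)
  | not (b : BExp)
  | and (b c : BExp)

inductive Cmd
  | skip
  | setI (a : ℕ) (i : IExp) (e : IExp)
  | setR (a : ℕ) (i : IExp) (e : RExp)
  | seq (p q : Cmd)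
  | ite (b : BExp) (p q : Cmd)
  | loop (b : BExp) (p : Cmd)

def IExp.eval (s : State) : IExp → ℕ
  | const k => k
  | get a i => s.ints a (i.eval s)
  | add e f => e.eval s + f.eval s
  | sub e f => e.eval s - f.eval s
  | mul e f => e.eval s * f.eval s
  | div e f => e.eval s / f.eval s

def RExp.eval (s : State) : RExp → ℝ
  | ofInt e => (e.eval s : ℝ)
  | get a i => s.reals a (i.eval s)
  | add e f => e.eval s + f.eval s
  | sub e f => e.eval s - f.eval s
  | mul e f => e.eval s * f.eval s

def BExp.Holds (s : State) : BExp → Prop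
  | ilt e f => e.eval s < f.eval s
  | ieq e f => e.eval s = f.eval s
  | rlt e f => e.eval s < f.eval s
  | not b => ¬ b.Holds s
  | and b c => b.Holds s ∧ c.Holds s

/-- The number of operations in an expression. -/
def IExp.cost : IExp → ℕ
  | const _ => 1
  | get _ i => i.cost + 1
  | add e f => e.cost + f.cost + 1
  | sub e f => e.cost + f.cost + 1
  | mul e f => e.cost + f.cost + 1
  | div e f => e.cost + f.cost + 1

def RExp.cost : RExp → ℕ
  | ofInt e => e.cost + 1
  | get _ i => i.cost + 1
  | add e f => e.cost + f.cost + 1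
  | sub e f => e.cost + f.cost + 1
  | mul e f => e.cost + f.cost + 1

def BExp.cost : BExp → ℕ
  | ilt e f => e.cost + f.cost + 1
  | ieq e f => e.cost + f.cost + 1
  | rlt e f => e.cost + f.cost + 1
  | not b => b.cost + 1
  | and b c => b.cost + c.cost + 1

def State.setI (s : State) (a i x : ℕ) : State :=
  { s with ints := Function.update s.ints a (Function.update (s.ints a) i x) }

noncomputable def State.setR (s : State) (a i : ℕ) (x : ℝ) : State :=
  { s with reals := Function.update s.reals a (Function.update (s.reals a) i x) }

/-- `Exec W p s s' t`: with word bound `W`, the program `p` started in the state `s` halts in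
the state `s'` after `t` steps. A program that tries to store a number `≥ W` in a word cell has no
execution. -/
inductive Exec (W : ℕ) : Cmd → State → State → ℕ → Prop
  | skip (s : State) : Exec W .skip s s 1
  | setI (s : State) (a : ℕ) (i e : IExp) : e.eval s < W →
      Exec W (.setI a i e) s (s.setI a (i.eval s) (e.eval s)) (i.cost + e.cost + 1)
  | setR (s : State) (a : ℕ) (i : IExp) (e : RExp) :
      Exec W (.setR a i e) s (s.setR a (i.eval s) (e.eval s)) (i.cost + e.cost + 1)
  | seq (p q : Cmd) (s s' s'' : State) (t t' : ℕ) : Exec W p s s' t → Exec W q s' s'' t' →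
      Exec W (.seq p q) s s'' (t + t')
  | iteTrue (b : BExp) (p q : Cmd) (s s' : State) (t : ℕ) : b.Holds s → Exec W p s s' t →
      Exec W (.ite b p q) s s' (b.cost + 1 + t)
  | iteFalse (b : BExp) (p q : Cmd) (s s' : State) (t : ℕ) : ¬ b.Holds s → Exec W q s s' t →
      Exec W (.ite b p q) s s' (b.cost + 1 + t)
  | loopTrue (b : BExp) (p : Cmd) (s s' s'' : State) (t t' : ℕ) : b.Holds s → Exec W p s s' t →
      Exec W (.loop b p) s' s'' t' → Exec W (.loop b p) s s'' (b.cost + 1 + t + t')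
  | loopFalse (b : BExp) (p : Cmd) (s : State) : ¬ b.Holds s →
      Exec W (.loop b p) s s (b.cost + 1)

end RAM

/-! ## Implementations of Greedy -/

namespace STC

/-- A list of the `m` edges of a graph on `0, …, n - 1`, each listed once, in any order and with
any orientation. -/
structure EdgeList {n : ℕ} (G : SimpleGraph (Fin n)) (m : ℕ) where
  src : Fin m → Fin n
  dst : Fin m → Fin n
  injective : Function.Injective fun e => s(src e, dst e)
  range_eq : Set.range (fun e => s(src e, dst e)) = G.edgeSet

def EdgeList.edge {n m : ℕ} {G : SimpleGraph (Fin n)} (E : EdgeList G m) (e : Fin m) :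
    Sym2 (Fin n) := s(E.src e, E.dst e)

/-- The input: word array 0 holds `n, m`, word arrays 1 and 2 hold the endpoints of the edges,
real array 0 holds `lam`; everything else is zero. -/
noncomputable def inputState {n m : ℕ} {G : SimpleGraph (Fin n)} (E : EdgeList G m) (lam : ℝ) :
    RAM.State where
  ints a i :=
    if a = 0 then (if i = 0 then n else if i = 1 then m else 0)
    else if a = 1 then (if h : i < m then (E.src ⟨i, h⟩ : ℕ) else 0)
    else if a = 2 then (if h : i < m then (E.dst ⟨i, h⟩ : ℕ) else 0)
    else 0
  reals a i := if a = 0 ∧ i = 0 then lam else 0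

/-- The memory holds the data that Greedy maintains, for the vertex set `U` and the matching `M`:
* word array 3, cell 0: the number of remaining vertices;
* word array 4: the indicator of `U`;
* word array 5: the indicator of `E(U)`;
* word array 6: the matching, as the partner of an edge plus one, or 0 if it has no partner;
* word arrays 7, 8, 9: the wedge graph of `(U, E(U))` by adjacency lists. Cell `e` of arrays 7 and 8
  holds the start and the length of the list of `e`, which is stored in array 9;
  a node of the wedge graph is deleted by clearing its entry in array 5;
* real array 1: the priorities of the remaining vertices. -/
structure Represents {n m : ℕ} {G : SimpleGraph (Fin n)} (E : EdgeList G m) (lam : ℝ)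
    (U : Finset (Fin n)) (M : Set (Sym2 (Sym2 (Fin n)))) (s : RAM.State) : Prop where
  count : s.ints 3 0 = U.card
  vertices : ∀ v : Fin n, s.ints 4 v = if v ∈ U then 1 else 0
  edges : ∀ e : Fin m, s.ints 5 e = if E.src e ∈ U ∧ E.dst e ∈ U then 1 else 0
  matching : ∀ e : Fin m,
    (∀ f : Fin m, s(E.edge e, E.edge f) ∈ M ↔ s.ints 6 e = (f : ℕ) + 1) ∧
    ((∀ f : Fin m, s(E.edge e, E.edge f) ∉ M) → s.ints 6 e = 0)
  wedges : ∀ e f : Fin m, (wedgeGraph (restrict G U)).Adj (E.edge e) (E.edge f) ↔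
    s.ints 5 e = 1 ∧ s.ints 5 f = 1 ∧ ∃ j < s.ints 8 e, s.ints 9 (s.ints 7 e + j) = (f : ℕ)
  priorities : ∀ v ∈ U, s.reals 1 (v : ℕ) = weightedDegree G lam U (weakEdges M) v

/-- The memory holds the output `(U, L)`: word array 10 is the indicator of `U`, and word array 11
is 1 at the weak edges and 0 at the strong edges of `E(U)`. -/
def IsOutput {n m : ℕ} {G : SimpleGraph (Fin n)} (E : EdgeList G m)
    (U : Finset (Fin n)) (L : Set (Sym2 (Fin n))) (s : RAM.State) : Prop :=
  (∀ v : Fin n, s.ints 10 v = if v ∈ U then 1 else 0) ∧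
  (∀ e : Fin m, E.src e ∈ U → E.dst e ∈ U →
    (E.edge e ∈ L → s.ints 11 e = 1) ∧ (E.edge e ∉ L → s.ints 11 e = 0))

/-- `init; while there are nodes do body; fin`. -/
def greedyProgram (init body fin : RAM.Cmd) : RAM.Cmd :=
  .seq init (.seq (.loop (.ilt (.const 0) (.get 3 (.const 0))) body) fin)

/-- On this input, the program carries out Greedy and halts after exactly `T` steps: the states
after the initialization and after each pass of the main loop represent the states of one run of
Greedy, and the output is a pair `(U, L)` with the largest score among the pairs that were tested
(the empty vertex set has no score and is not tested). -/
def CarriesOutGreedy {n m : ℕ} {G : SimpleGraph (Fin n)} (W : ℕ) (init body fin : RAM.Cmd)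
    (E : EdgeList G m) (lam : ℝ) (T : ℕ) : Prop :=
  ∃ (U : ℕ → Finset (Fin n)) (M : ℕ → Set (Sym2 (Sym2 (Fin n)))) (u : ℕ → Fin n)
    (σ : ℕ → RAM.State) (out : RAM.State),
    GreedyRun G lam U M u ∧
    (∃ t, RAM.Exec W init (inputState E lam) (σ 0) t) ∧
    (∀ i < n, ∃ t, RAM.Exec W body (σ i) (σ (i + 1)) t) ∧
    (∀ i ≤ n, Represents E lam (U i) (M i) (σ i)) ∧
    RAM.Exec W (greedyProgram init body fin) (inputState E lam) out T ∧
    ∃ i < n, (∀ j < n, score G lam (U j) (weakEdges (M j)) ≤ score G lam (U i) (weakEdges (M i))) ∧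
      IsOutput E (U i) (weakEdges (M i)) out

/-- The bound `mn + (n' + m') + m log n + nm`, where `n'` and `m'` are the numbers of nodes and
edges of the wedge graph. -/
noncomputable def greedyBound {n : ℕ} (G : SimpleGraph (Fin n)) (m : ℕ) : ℝ :=
  (m : ℝ) * n + (((wedgeNodes G).ncard : ℝ) + ((wedgeGraph G).edgeSet.ncard : ℝ))
    + m * Real.log n + n * m

end STC

/-! Deleting the nodes of `N` can uncover only the partners of nodes of `N`, and such a partner is
matched again at once if it still has an uncovered neighbour; hence the matching stays maximal.

For the running time, the wedge graph is computed once, in `O(nm)` steps, from an adjacency matrix: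
an edge `xy` forms at most one wedge with each further vertex, so its adjacency list has at most `n`
entries. Deleting a vertex only clears marks. A pass costs `O(m)` for finding the minimum and
recomputing the weighted degrees from the edge list, and `O(n)` for each edge at the deleted vertex;
the degrees add up to `2m`, which gives `O(nm)` in total. As `m` may be much smaller than `n`,
searching through all vertices for the minimum is too expensive: the vertices on no edge have
weighted degree `0` throughout, and are kept on a stack of which only the top is a candidate. For
the same reason the vertex set of the best pair is not copied when it is found. Only its labels and
its size are recorded, and the set is recovered from the times of deletion. -/

/-! ## Maximal matchings under deletion of nodes -/

namespace STC

section Matching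

variable {α : Type*} {Z Z' : SimpleGraph α} {M M' : Set (Sym2 α)} {N : Set α} {a b c : α}
  {l : List α}

/-- `M` is a matching of the graph `Z`. -/
structure IsMatching (Z : SimpleGraph α) (M : Set (Sym2 α)) : Prop where
  subset : M ⊆ Z.edgeSet
  eq_of_mem : ∀ p ∈ M, ∀ q ∈ M, ∀ a, a ∈ p → a ∈ q → p = q

theorem covered_insert : Covered (insert s(a, b) M) c ↔ c = a ∨ c = b ∨ Covered M c := by
  simp [Covered, or_assoc]

theorem covered_of_mem (h : s(a, b) ∈ M) : Covered M a := ⟨_, h, Sym2.mem_mk_left a b⟩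

theorem covered_iff_exists_partner : Covered M a ↔ ∃ b, s(a, b) ∈ M := by
  refine ⟨fun ⟨p, hp, ha⟩ => ?_, fun ⟨b, hb⟩ => covered_of_mem hb⟩
  obtain ⟨b, rfl⟩ := Sym2.mem_iff_exists.1 ha
  exact ⟨b, hp⟩

namespace IsMatching

theorem empty (Z : SimpleGraph α) : IsMatching Z ∅ := ⟨Set.empty_subset _, by simp⟩

theorem of_subset (h : IsMatching Z M) (hM : M' ⊆ M) : IsMatching Z M' :=
  ⟨hM.trans h.subset, fun p hp q hq => h.eq_of_mem p (hM hp) q (hM hq)⟩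

theorem insert (h : IsMatching Z M) (hab : Z.Adj a b) (ha : ¬ Covered M a) (hb : ¬ Covered M b) :
    IsMatching Z (insert s(a, b) M) := by
  have disjoint : ∀ q ∈ M, ∀ c ∈ s(a, b), c ∉ q := by
    intro q hq c hc hcq
    rcases Sym2.mem_iff.1 hc with rfl | rfl
    exacts [ha ⟨q, hq, hcq⟩, hb ⟨q, hq, hcq⟩]
  refine ⟨Set.insert_subset hab h.subset, ?_⟩
  rintro p (rfl | hp) q (rfl | hq) c hcp hcq
  · rfl
  · exact absurd hcq (disjoint q hq c hcp)
  · exact absurd hcp (disjoint p hp c hcq)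
  · exact h.eq_of_mem p hp q hq c hcp hcq

theorem covered_diff_iff (h : IsMatching Z M) (hab : s(a, b) ∈ M) :
    Covered (M \ {s(a, b)}) c ↔ Covered M c ∧ c ≠ a ∧ c ≠ b := by
  constructor
  · rintro ⟨p, ⟨hp, hpab⟩, hc⟩
    exact ⟨⟨p, hp, hc⟩,
      fun hca => hpab (h.eq_of_mem p hp _ hab c hc (hca ▸ Sym2.mem_mk_left a b)),
      fun hcb => hpab (h.eq_of_mem p hp _ hab c hc (hcb ▸ Sym2.mem_mk_right a b))⟩
  · rintro ⟨⟨p, hp, hc⟩, hca, hcb⟩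
    refine ⟨p, ⟨hp, ?_⟩, hc⟩
    rintro rfl
    exact (Sym2.mem_iff.1 hc).elim hca hcb

end IsMatching

theorem AprReach.isMatching (h : AprReach Z M) : IsMatching Z M := by
  induction h with
  | empty => exact .empty Z
  | pick M a b _ hab ha hb ih => exact ih.insert hab ha hb

theorem AprMatching.isMaximalMatching (h : AprMatching Z M) : IsMaximalMatching Z M := by
  refine ⟨h.1.isMatching.subset, h.1.isMatching.eq_of_mem, fun a b hab => ?_⟩
  by_contra! hc
  exact h.2 ⟨a, b, hab, hc⟩

/-- `Z'` is `Z` after the deletion of the nodes in `N`, which stay behind as isolated nodes. -/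
def IsDeletion (Z : SimpleGraph α) (N : Set α) (Z' : SimpleGraph α) : Prop :=
  ∀ a b, Z'.Adj a b ↔ Z.Adj a b ∧ a ∉ N ∧ b ∉ N

theorem IsDeletion.not_mem (hZ : IsDeletion Z N Z') (h : Z'.Adj a b) : a ∉ N := ((hZ a b).1 h).2.1

/-- The invariant of the loop of Dynamic-Vertex-Cover when the nodes of `N` that are still to be
processed are those in `l`. -/
structure DynInvariant (Z Z' : SimpleGraph α) (N : Set α) (l : List α) (M : Set (Sym2 α)) :
    Prop where
  isMatching : IsMatching Z M
  covers : ∀ a b, Z'.Adj a b → Covered M a ∨ Covered M b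
  mem_of_covered : ∀ a ∈ N, Covered M a → a ∈ l

namespace DynInvariant

theorem covers_diff (h : DynInvariant Z Z' N l M) (hZ : IsDeletion Z N Z') (haN : a ∈ N)
    (hab : s(a, b) ∈ M) {x y : α} (hxy : Z'.Adj x y) :
    x = b ∨ y = b ∨ Covered (M \ {s(a, b)}) x ∨ Covered (M \ {s(a, b)}) y := by
  have hx : x ≠ a := fun hxa => hZ.not_mem hxy (hxa ▸ haN)
  have hy : y ≠ a := fun hya => hZ.not_mem hxy.symm (hya ▸ haN)
  have := h.covers x y hxy
  simp only [h.isMatching.covered_diff_iff hab]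
  tauto

theorem mem_of_covered_diff (h : DynInvariant Z Z' N (a :: l) M) (hab : s(a, b) ∈ M) (hc : c ∈ N)
    (hcov : Covered (M \ {s(a, b)}) c) : c ∈ l := by
  obtain ⟨hcM, hca, -⟩ := (h.isMatching.covered_diff_iff hab).1 hcov
  exact (List.mem_cons.1 (h.mem_of_covered c hc hcM)).resolve_left hca

theorem unmatched (h : DynInvariant Z Z' N (a :: l) M) (ha : ¬ ∃ b, s(a, b) ∈ M) :
    DynInvariant Z Z' N l M where
  isMatching := h.isMatching
  covers := h.covers
  mem_of_covered c hc hcov := by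
    refine (List.mem_cons.1 (h.mem_of_covered c hc hcov)).resolve_left ?_
    rintro rfl
    exact ha (covered_iff_exists_partner.1 hcov)

theorem replace (h : DynInvariant Z Z' N (a :: l) M) (hZ : IsDeletion Z N Z') (haN : a ∈ N)
    (hab : s(a, b) ∈ M) {t : α} (ht : IsReplacement Z' N (M \ {s(a, b)}) b t) :
    DynInvariant Z Z' N l (insert s(b, t) (M \ {s(a, b)})) where
  isMatching := (h.isMatching.of_subset Set.sdiff_subset).insert ((hZ b t).1 ht.2.2.2).1
    (by simp [h.isMatching.covered_diff_iff hab]) ht.2.2.1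
  covers x y hxy := by
    have := h.covers_diff hZ haN hab hxy
    simp only [covered_insert]
    tauto
  mem_of_covered c hc hcov := by
    rcases covered_insert.1 hcov with rfl | rfl | hcov
    exacts [absurd hc ht.1, absurd hc ht.2.1, h.mem_of_covered_diff hab hc hcov]

theorem drop (h : DynInvariant Z Z' N (a :: l) M) (hZ : IsDeletion Z N Z') (haN : a ∈ N)
    (hab : s(a, b) ∈ M) (hno : ¬ ∃ t, IsReplacement Z' N (M \ {s(a, b)}) b t) :
    DynInvariant Z Z' N l (M \ {s(a, b)}) where
  isMatching := h.isMatching.of_subset Set.sdiff_subset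
  covers x y hxy := by
    have neighbour_covered : ∀ t, Z'.Adj b t → Covered (M \ {s(a, b)}) t := fun t hbt => by
      by_contra hc
      exact hno ⟨t, hZ.not_mem hbt, hZ.not_mem hbt.symm, hc, hbt⟩
    rcases h.covers_diff hZ haN hab hxy with rfl | rfl | hc
    exacts [Or.inr (neighbour_covered y hxy), Or.inl (neighbour_covered x hxy.symm), hc]
  mem_of_covered _ := h.mem_of_covered_diff hab

theorem step (h : DynInvariant Z Z' N (a :: l) M) (hZ : IsDeletion Z N Z') (haN : a ∈ N)
    (hs : DynStep Z' N a M M') : DynInvariant Z Z' N l M' := by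
  cases hs with
  | unmatched ha => exact h.unmatched ha
  | replace b t hab ht => exact h.replace hZ haN hab ht
  | drop b hab hno => exact h.drop hZ haN hab hno

theorem loop (h : DynInvariant Z Z' N l M) (hZ : IsDeletion Z N Z') (hl : ∀ a ∈ l, a ∈ N)
    (hs : DynLoop Z' N l M M') : DynInvariant Z Z' N [] M' := by
  induction hs with
  | nil => exact h
  | cons a l M M' _ hstep _ ih =>
    rw [List.forall_mem_cons] at hl
    exact ih (h.step hZ hl.1 hstep) hl.2

end DynInvariant

theorem DynamicVertexCover.isMaximalMatching (hs : DynamicVertexCover Z' N M M')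
    (hZ : IsDeletion Z N Z') (h : IsMaximalMatching Z M) : IsMaximalMatching Z' M' := by
  obtain ⟨l, -, hl, hloop⟩ := hs
  have start : DynInvariant Z Z' N l M :=
    ⟨⟨h.1, h.2.1⟩, fun a b hab => h.2.2 a b ((hZ a b).1 hab).1, fun a haN _ => (hl a).2 haN⟩
  have final := start.loop hZ (fun a => (hl a).1) hloop
  have not_mem : ∀ a, Covered M' a → a ∉ N := fun a ha haN => by
    simpa using final.mem_of_covered a haN ha
  refine ⟨fun p hp => ?_, final.isMatching.eq_of_mem, final.covers⟩
  induction p with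
  | _ x y =>
    exact (hZ x y).2 ⟨final.isMatching.subset hp, not_mem x ⟨_, hp, Sym2.mem_mk_left x y⟩,
      not_mem y ⟨_, hp, Sym2.mem_mk_right x y⟩⟩

end Matching

/-! ## Wedge graphs of induced subgraphs -/

section WedgeGraph

variable {V : Type*} (G : SimpleGraph V) (U : Finset V)

theorem mem_edgeSet_of_wedgeGraph_adj {G : SimpleGraph V} {e f : Sym2 V}
    (h : (wedgeGraph G).Adj e f) : e ∈ G.edgeSet := by
  obtain ⟨x, y, z, h, rfl, rfl⟩ := h
  exact h.1

theorem mem_restrict_edgeSet (e : Sym2 V) :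
    e ∈ (restrict G U).edgeSet ↔ e ∈ G.edgeSet ∧ ∀ v ∈ e, v ∈ U := by
  induction e with
  | _ x y => simp [restrict]

theorem restrict_univ [Fintype V] : restrict G Finset.univ = G := by
  ext x y; simp [restrict]

theorem wedgeGraph_restrict_adj (e f : Sym2 V) :
    (wedgeGraph (restrict G U)).Adj e f ↔
      (wedgeGraph G).Adj e f ∧ (∀ v ∈ e, v ∈ U) ∧ ∀ v ∈ f, v ∈ U := by
  constructor
  · rintro ⟨x, y, z, ⟨hxy, hyz, hne, hxz⟩, rfl, rfl⟩
    refine ⟨⟨x, y, z, ⟨hxy.1, hyz.1, hne, fun h => hxz ⟨h, hxy.2.1, hyz.2.2⟩⟩, rfl, rfl⟩, ?_, ?_⟩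
    · simp [hxy.2.1, hxy.2.2]
    · simp [hyz.2.1, hyz.2.2]
  · rintro ⟨⟨x, y, z, ⟨hxy, hyz, hne, hxz⟩, rfl, rfl⟩, he, hf⟩
    simp only [Sym2.mem_iff, forall_eq_or_imp, forall_eq] at he hf
    exact ⟨x, y, z, ⟨⟨hxy, he⟩, ⟨hyz, hf⟩, hne, fun h => hxz h.1⟩, rfl, rfl⟩

theorem forall_mem_erase_iff [DecidableEq V] {e : Sym2 V} (he : e ∈ G.edgeSet) (u : V) :
    (∀ v ∈ e, v ∈ U.erase u) ↔ (∀ v ∈ e, v ∈ U) ∧ e ∉ (restrict G U).incidenceSet u := by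
  have incident : e ∈ (restrict G U).incidenceSet u ↔ (∀ v ∈ e, v ∈ U) ∧ u ∈ e := by
    rw [SimpleGraph.incidenceSet, Set.mem_sep_iff, mem_restrict_edgeSet]
    tauto
  simp only [incident, Finset.mem_erase, ne_eq, not_and]
  constructor
  · exact fun h => ⟨fun v hv => (h v hv).2, fun _ hu => (h u hu).1 rfl⟩
  · rintro ⟨hU, hu⟩ v hv
    exact ⟨fun hvu => hu hU (hvu ▸ hv), hU v hv⟩

theorem isDeletion_wedgeGraph_erase [DecidableEq V] (u : V) :
    IsDeletion (wedgeGraph (restrict G U)) ((restrict G U).incidenceSet u)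
      (wedgeGraph (restrict G (U.erase u))) := by
  intro e f
  simp only [wedgeGraph_restrict_adj, and_assoc]
  refine and_congr_right fun h => ?_
  rw [forall_mem_erase_iff G U (mem_edgeSet_of_wedgeGraph_adj h),
    forall_mem_erase_iff G U (mem_edgeSet_of_wedgeGraph_adj h.symm)]
  tauto

theorem GreedyRun.isMaximalMatching [Fintype V] [DecidableEq V] {G : SimpleGraph V} {lam : ℝ}
    {U : ℕ → Finset V} {M : ℕ → Set (Sym2 (Sym2 V))} {u : ℕ → V} (h : GreedyRun G lam U M u)
    {i : ℕ} (hi : i ≤ Fintype.card V) :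
    IsMaximalMatching (wedgeGraph (restrict G (U i))) (M i) := by
  induction i with
  | zero =>
    rw [h.start_vertices, restrict_univ]
    exact h.start_matching.isMaximalMatching
  | succ i ih =>
    refine (h.relabel i hi).isMaximalMatching ?_ (ih (Nat.le_of_succ_le hi))
    rw [h.delete i hi]
    exact isDeletion_wedgeGraph_erase G (U i) (u i)

theorem wedgeNodes_ncard_le [Finite V] : (wedgeNodes G).ncard ≤ G.edgeSet.ncard :=
  Set.ncard_le_ncard fun _ ⟨_, h⟩ => mem_edgeSet_of_wedgeGraph_adj h

theorem wedgeGraph_edgeSet_ncard_le [Fintype V] :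
    (wedgeGraph G).edgeSet.ncard ≤ 2 * G.edgeSet.ncard * Fintype.card V := by
  classical
  let wedge : G.Dart × V → Sym2 (Sym2 V) := fun p => s(s(p.1.fst, p.1.snd), s(p.1.snd, p.2))
  have hsub : (wedgeGraph G).edgeSet ⊆ Set.range wedge := by
    intro p hp
    induction p with
    | _ e f =>
      obtain ⟨x, y, z, h, rfl, rfl⟩ := hp
      exact ⟨(⟨(x, y), h.1⟩, z), rfl⟩
  calc (wedgeGraph G).edgeSet.ncard ≤ (Set.range wedge).ncard := Set.ncard_le_ncard hsub
    _ ≤ Nat.card (G.Dart × V) := by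
      rw [← Set.image_univ, ← Set.ncard_univ]
      exact Set.ncard_image_le
    _ = 2 * G.edgeSet.ncard * Fintype.card V := by
      rw [Nat.card_eq_fintype_card, Fintype.card_prod, SimpleGraph.dart_card_eq_twice_card_edges,
        ← SimpleGraph.coe_edgeFinset, Set.ncard_coe_finset]

end WedgeGraph

section GreedyBound

variable {n m : ℕ} (G : SimpleGraph (Fin n))

theorem greedyBound_le (hm : G.edgeSet.ncard = m) : greedyBound G m ≤ 6 * ((n : ℝ) * m) := by
  have hmn : (m : ℝ) ≤ n * m := by
    rcases n.eq_zero_or_pos with rfl | hn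
    · simp [← hm, Set.eq_empty_of_isEmpty]
    · exact le_mul_of_one_le_left m.cast_nonneg (by exact_mod_cast hn)
  have hnodes : ((wedgeNodes G).ncard : ℝ) ≤ m := by exact_mod_cast hm ▸ wedgeNodes_ncard_le G
  have hedges : ((wedgeGraph G).edgeSet.ncard : ℝ) ≤ 2 * m * n := by
    exact_mod_cast hm ▸ Fintype.card_fin n ▸ wedgeGraph_edgeSet_ncard_le G
  have hlog : (m : ℝ) * Real.log n ≤ m * n := by
    gcongr
    exact Real.log_le_self n.cast_nonneg
  unfold greedyBound
  linarith

theorem mul_le_greedyBound (m : ℕ) : (n : ℝ) * m ≤ greedyBound G m :=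
  le_add_of_nonneg_left (by positivity)

end GreedyBound

end STC

/-! ## Reasoning about programs -/

namespace RAM

variable {W : ℕ} {p q : Cmd} {s s' s'' : State} {T T' : ℕ} {Q Q' : State → Prop}

@[simp] theorem State.setI_ints (s : State) (a i x b : ℕ) : (s.setI a i x).ints b =
    if b = a then Function.update (s.ints a) i x else s.ints b := by
  simp [State.setI, Function.update_apply]

@[simp] theorem State.setI_reals (s : State) (a i x : ℕ) : (s.setI a i x).reals = s.reals := rfl

@[simp] theorem State.setR_reals (s : State) (a i : ℕ) (x : ℝ) (b : ℕ) : (s.setR a i x).reals b =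
    if b = a then Function.update (s.reals a) i x else s.reals b := by
  simp [State.setR, Function.update_apply]

@[simp] theorem State.setR_ints (s : State) (a i : ℕ) (x : ℝ) : (s.setR a i x).ints = s.ints := rfl

/-- The word arrays that a program may write to; a boolean, so that `rfl` decides it. -/
def Cmd.writesI : Cmd → ℕ → Bool
  | skip, _ => false
  | setI b _ _, a => b == a
  | setR _ _ _, _ => false
  | seq p q, a => p.writesI a || q.writesI a
  | ite _ p q, a => p.writesI a || q.writesI a
  | loop _ p, a => p.writesI a

/-- The real arrays that a program may write to; a boolean, so that `rfl` decides it. -/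
def Cmd.writesR : Cmd → ℕ → Bool
  | skip, _ => false
  | setI _ _ _, _ => false
  | setR b _ _, a => b == a
  | seq p q, a => p.writesR a || q.writesR a
  | ite _ p q, a => p.writesR a || q.writesR a
  | loop _ p, a => p.writesR a

/-- The frame condition: `s` and `s'` agree on the arrays that `p` does not write to. -/
structure Frame (p : Cmd) (s s' : State) : Prop where
  ints : ∀ {a}, p.writesI a = false → s'.ints a = s.ints a
  reals : ∀ {a}, p.writesR a = false → s'.reals a = s.reals a

namespace Frame

theorem refl (p : Cmd) (s : State) : Frame p s s := ⟨fun _ => rfl, fun _ => rfl⟩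

theorem trans (h : Frame p s s') (h' : Frame p s' s'') : Frame p s s'' :=
  ⟨fun ha => (h'.ints ha).trans (h.ints ha), fun ha => (h'.reals ha).trans (h.reals ha)⟩

theorem mono (h : Frame q s s') (hI : ∀ a, p.writesI a = false → q.writesI a = false)
    (hR : ∀ a, p.writesR a = false → q.writesR a = false) : Frame p s s' :=
  ⟨fun ha => h.ints (hI _ ha), fun ha => h.reals (hR _ ha)⟩

theorem setI {a : ℕ} (h : p.writesI a = true) (s : State) (i x : ℕ) : Frame p s (s.setI a i x) where
  ints {b} hb := by
    have hne : b ≠ a := by rintro rfl; simp [h] at hb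
    simp [hne]
  reals _ := rfl

theorem setR {a : ℕ} (h : p.writesR a = true) (s : State) (i : ℕ) (x : ℝ) :
    Frame p s (s.setR a i x) where
  ints _ := rfl
  reals {b} hb := by
    have hne : b ≠ a := by rintro rfl; simp [h] at hb
    simp [hne]

end Frame

theorem Exec.frame {t : ℕ} (h : Exec W p s s' t) : Frame p s s' := by
  induction h with
  | skip s => exact .refl _ s
  | setI s a i e _ => exact .setI (by simp [Cmd.writesI]) s _ _
  | setR s a i e => exact .setR (by simp [Cmd.writesR]) s _ _
  | seq _ _ _ _ _ _ _ _ _ ih ih' =>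
    exact (ih.mono (by simp +contextual [Cmd.writesI]) (by simp +contextual [Cmd.writesR])).trans
      (ih'.mono (by simp +contextual [Cmd.writesI]) (by simp +contextual [Cmd.writesR]))
  | iteTrue _ _ _ _ _ _ _ _ ih | iteFalse _ _ _ _ _ _ _ _ ih =>
    exact ih.mono (by simp +contextual [Cmd.writesI]) (by simp +contextual [Cmd.writesR])
  | loopTrue _ _ _ _ _ _ _ _ _ _ ih ih' =>
    exact (ih.mono (by simp [Cmd.writesI]) (by simp [Cmd.writesR])).trans ih'
  | loopFalse _ _ s => exact .refl _ s

/-- Total correctness with a time bound: started in `s`, the program `p` halts within `T` steps in a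
state that satisfies `Q`. -/
def Runs (W : ℕ) (p : Cmd) (s : State) (T : ℕ) (Q : State → Prop) : Prop :=
  ∃ s' t, Exec W p s s' t ∧ t ≤ T ∧ Q s'

namespace Runs

theorem mono (h : Runs W p s T Q) (hT : T ≤ T') (hQ : ∀ s', Q s' → Frame p s s' → Q' s') :
    Runs W p s T' Q' := by
  obtain ⟨s', t, he, ht, hq⟩ := h
  exact ⟨s', t, he, ht.trans hT, hQ s' hq he.frame⟩

theorem mono_time (h : Runs W p s T Q) (hT : T ≤ T') : Runs W p s T' Q :=
  h.mono hT fun _ hq _ => hq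

theorem seq (h : Runs W p s T Q) (h' : ∀ s', Q s' → Frame p s s' → Runs W q s' T' Q') :
    Runs W (.seq p q) s (T + T') Q' := by
  obtain ⟨s', t, he, ht, hq⟩ := h
  obtain ⟨s'', t', he', ht', hq'⟩ := h' s' hq he.frame
  exact ⟨s'', t + t', .seq _ _ _ _ _ _ _ he he', Nat.add_le_add ht ht', hq'⟩

theorem ite {b : BExp} (h : b.Holds s → Runs W p s T Q) (h' : ¬ b.Holds s → Runs W q s T Q) :
    Runs W (.ite b p q) s (b.cost + 1 + T) Q := by
  by_cases hb : b.Holds s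
  · obtain ⟨s', t, he, ht, hq⟩ := h hb
    exact ⟨s', _, .iteTrue _ _ _ _ _ _ hb he, by omega, hq⟩
  · obtain ⟨s', t, he, ht, hq⟩ := h' hb
    exact ⟨s', _, .iteFalse _ _ _ _ _ _ hb he, by omega, hq⟩

end Runs

/-- The weakest precondition of a loop-free program for the postcondition `Q`; it is `False` where
the program contains a loop. -/
def Cmd.wp (W : ℕ) : Cmd → (State → Prop) → State → Prop
  | skip, Q, s => Q s
  | setI a i e, Q, s => e.eval s < W ∧ Q (s.setI a (i.eval s) (e.eval s))
  | setR a i e, Q, s => Q (s.setR a (i.eval s) (e.eval s))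
  | seq p q, Q, s => p.wp W (q.wp W Q) s
  | ite b p q, Q, s => (b.Holds s → p.wp W Q s) ∧ (¬ b.Holds s → q.wp W Q s)
  | loop _ _, _, _ => False

/-- A bound on the running time of a loop-free program, with the junk value `0` at loops. -/
def Cmd.loopFreeCost : Cmd → ℕ
  | skip => 1
  | setI _ i e => i.cost + e.cost + 1
  | setR _ i e => i.cost + e.cost + 1
  | seq p q => p.loopFreeCost + q.loopFreeCost
  | ite b p q => b.cost + 1 + (p.loopFreeCost + q.loopFreeCost)
  | loop _ _ => 0

theorem Runs.of_wp (h : p.wp W Q s) : Runs W p s p.loopFreeCost Q := by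
  induction p generalizing s Q with
  | skip => exact ⟨s, _, .skip s, le_rfl, h⟩
  | setI a i e => exact ⟨_, _, .setI s a i e h.1, le_rfl, h.2⟩
  | setR a i e => exact ⟨_, _, .setR s a i e, le_rfl, h⟩
  | seq p q ihp ihq => exact (ihp h).seq fun s' hs' _ => ihq hs'
  | ite b p q ihp ihq =>
    exact .ite (fun hb => (ihp (h.1 hb)).mono_time (by omega))
      fun hb => (ihq (h.2 hb)).mono_time (by omega)
  | loop => exact h.elim

/-- The scalar word variable `a`, stored in the first cell of the word array `a`. -/
abbrev var (a : ℕ) : IExp := .get a (.const 0)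

/-- Assignment to a scalar word variable. -/
abbrev assign (a : ℕ) (e : IExp) : Cmd := .setI a (.const 0) e

/-- The scalar real variable `a`, stored in the first cell of the real array `a`. -/
abbrev varR (a : ℕ) : RExp := .get a (.const 0)

/-- Assignment to a scalar real variable. -/
abbrev assignR (a : ℕ) (e : RExp) : Cmd := .setR a (.const 0) e

/-- `while a < k do (p; a := a + 1)`. -/
def countUp (a : ℕ) (k : IExp) (p : Cmd) : Cmd :=
  .loop (.ilt (var a) k) (.seq p (assign a (.add (var a) (.const 1))))

/-- `for a = 0, …, k - 1 do p`. -/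
def forLoop (a : ℕ) (k : IExp) (p : Cmd) : Cmd :=
  .seq (assign a (.const 0)) (countUp a k p)

theorem exec_increment {a i : ℕ} (hi : i + 1 < W) (ha : s.ints a 0 = i) :
    Exec W (assign a (.add (var a) (.const 1))) s (s.setI a 0 (i + 1)) 6 := by
  simpa [IExp.eval, IExp.cost, ha] using
    Exec.setI (W := W) s a (.const 0) (.add (var a) (.const 1)) (by simpa [IExp.eval, ha])

theorem Frame.forLoop_setI (a : ℕ) (k : IExp) (p : Cmd) (s : State) (x : ℕ) :
    Frame (forLoop a k p) s (s.setI a 0 x) :=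
  .setI (by simp [forLoop, Cmd.writesI]) s 0 x

theorem Frame.forLoop_of_body {a : ℕ} {k : IExp} (h : Frame p s s') : Frame (forLoop a k p) s s' :=
  h.mono (by simp +contextual [forLoop, countUp, Cmd.writesI])
    (by simp +contextual [forLoop, countUp, Cmd.writesR])

section Loops

variable {a N : ℕ} {k : IExp} (I : ℕ → State → Prop) (time : ℕ → ℕ)

theorem Runs.countUp (hN : N < W) (hp : p.writesI a = false)
    (hk : ∀ i s, I i s → k.eval s = N)
    (hstep : ∀ i s, i < N → I i s → s.ints a 0 = i →
      Runs W p s (time i) fun s' => I (i + 1) (s'.setI a 0 (i + 1)))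
    {i : ℕ} (hi : i ≤ N) (hI : I i s) (ha : s.ints a 0 = i) :
    Runs W (countUp a k p) s (∑ j ∈ Finset.Ico i N, (time j + (k.cost + 10)) + (k.cost + 4))
      (I N) := by
  induction hi using Nat.decreasingInduction generalizing s with
  | self =>
    refine ⟨s, _, .loopFalse _ _ _ ?_, ?_, hI⟩
    · simp [BExp.Holds, IExp.eval, ha, hk _ _ hI]
    · simp only [Finset.Ico_self, Finset.sum_empty, BExp.cost, IExp.cost]
      omega
  | of_succ i hi ih =>
    obtain ⟨s', t, he, ht, hI'⟩ := hstep i s hi hI ha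
    have hinc := exec_increment (Nat.lt_of_le_of_lt hi hN) (by rw [he.frame.ints hp, ha])
    obtain ⟨s'', t', he', ht', hq⟩ := ih hI' (by simp)
    refine ⟨s'', _, .loopTrue _ _ _ _ _ _ _ ?_ (.seq _ _ _ _ _ _ _ he hinc) he', ?_, hq⟩
    · simp [BExp.Holds, IExp.eval, ha, hk _ _ hI, hi]
    · rw [Finset.sum_eq_sum_Ico_succ_bot hi]
      simp only [BExp.cost, IExp.cost]
      omega

theorem Runs.forLoop (hN : N < W) (hp : p.writesI a = false)
    (hk : ∀ s', Frame (forLoop a k p) s s' → k.eval s' = N) (h0 : I 0 (s.setI a 0 0))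
    (hstep : ∀ i s', i < N → Frame (RAM.forLoop a k p) s s' → I i s' → s'.ints a 0 = i →
      Runs W p s' (time i) fun s'' => I (i + 1) (s''.setI a 0 (i + 1))) :
    Runs W (forLoop a k p) s (∑ j ∈ Finset.range N, time j + (k.cost + 10) * (N + 1)) (I N) := by
  have hinit : Exec W (assign a (.const 0)) s (s.setI a 0 0) 3 :=
    .setI s a (.const 0) (.const 0) (Nat.zero_lt_of_lt hN)
  obtain ⟨s', t, he, ht, -, hq⟩ := Runs.countUp
    (fun i s' => Frame (RAM.forLoop a k p) s s' ∧ I i s') time hN hp (fun _ s' h => hk s' h.1)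
    (fun i s' hi h ha => (hstep i s' hi h.1 h.2 ha).mono le_rfl fun s'' h'' hF =>
      ⟨(h.1.trans hF.forLoop_of_body).trans (.forLoop_setI a k p _ _), h''⟩)
    N.zero_le ⟨.forLoop_setI a k p s 0, h0⟩ (by simp)
  refine ⟨s', _, .seq _ _ _ _ _ _ _ hinit he, ?_, hq⟩
  rw [Finset.sum_add_distrib, ← Finset.range_eq_Ico, Finset.sum_const, Finset.card_range,
    smul_eq_mul, Nat.mul_comm N] at ht
  rw [Nat.mul_succ]
  omega

theorem Runs.forLoop_const {C : ℕ} (hC : T + k.cost + 10 ≤ C) (hN : N < W)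
    (hp : p.writesI a = false)
    (hk : ∀ s', Frame (RAM.forLoop a k p) s s' → k.eval s' = N) (h0 : I 0 (s.setI a 0 0))
    (hstep : ∀ i s', i < N → Frame (RAM.forLoop a k p) s s' → I i s' → s'.ints a 0 = i →
      Runs W p s' T fun s'' => I (i + 1) (s''.setI a 0 (i + 1))) :
    Runs W (RAM.forLoop a k p) s (C * (N + 1)) (I N) := by
  refine (Runs.forLoop I (fun _ => T) hN hp hk h0 hstep).mono_time ?_
  calc ∑ _ ∈ Finset.range N, T + (k.cost + 10) * (N + 1)
      ≤ (T + k.cost + 10) * (N + 1) := by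
        rw [Finset.sum_const, Finset.card_range, smul_eq_mul]
        nlinarith
    _ ≤ C * (N + 1) := Nat.mul_le_mul_right _ hC

theorem Runs.forLoop_wp {C : ℕ} (hC : p.loopFreeCost + k.cost + 10 ≤ C) (hN : N < W)
    (hp : p.writesI a = false)
    (hk : ∀ s', Frame (RAM.forLoop a k p) s s' → k.eval s' = N) (h0 : I 0 (s.setI a 0 0))
    (hstep : ∀ i s', i < N → Frame (RAM.forLoop a k p) s s' → I i s' → s'.ints a 0 = i →
      p.wp W (fun s'' => I (i + 1) (s''.setI a 0 (i + 1))) s') :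
    Runs W (RAM.forLoop a k p) s (C * (N + 1)) (I N) :=
  Runs.forLoop_const I hC hN hp hk h0 fun i s' hi hF hI ha => .of_wp (hstep i s' hi hF hI ha)

end Loops

end RAM

/-! ## Edge lists -/

namespace STC

section Dynamic

variable {α : Type*} {Z : SimpleGraph α} {N P : Set α} {a : α} {M M' M'' : Set (Sym2 α)}

theorem DynLoop.concat {l : List α} (h : DynLoop Z N l M M') (h' : DynStep Z N a M' M'') :
    DynLoop Z N (l ++ [a]) M M'' := by
  induction h with
  | nil => exact .cons _ _ _ _ _ h' (.nil _)
  | cons _ _ _ _ _ hs _ ih => exact .cons _ _ _ _ _ hs (ih h')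

/-- Dynamic-Vertex-Cover has turned `M` into `M'` by processing exactly the nodes in `P`. For
`P = N` this is `DynamicVertexCover`. -/
def DynUpdated (Z : SimpleGraph α) (N P : Set α) (M M' : Set (Sym2 α)) : Prop :=
  ∃ l : List α, l.Nodup ∧ (∀ a, a ∈ l ↔ a ∈ P) ∧ DynLoop Z N l M M'

theorem DynUpdated.empty (Z : SimpleGraph α) (N : Set α) (M : Set (Sym2 α)) :
    DynUpdated Z N ∅ M M :=
  ⟨[], by simp, by simp, .nil M⟩

protected theorem DynUpdated.insert (h : DynUpdated Z N P M M') (ha : a ∉ P)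
    (hs : DynStep Z N a M' M'') : DynUpdated Z N (insert a P) M M'' := by
  obtain ⟨l, hl, hmem, hloop⟩ := h
  refine ⟨l ++ [a], ?_, fun b => ?_, hloop.concat hs⟩
  · rw [List.nodup_append]
    refine ⟨hl, List.nodup_singleton a, ?_⟩
    rintro b hb c hc rfl
    exact ha (List.mem_singleton.1 hc ▸ (hmem b).1 hb)
  · rw [List.mem_append, List.mem_singleton, hmem, Set.mem_insert_iff, or_comm]

end Dynamic

open Classical in
/-- The contribution of the edge `e` to the score and to the weighted degrees of its endpoints. -/
noncomputable def edgeWeight {V : Type*} (G : SimpleGraph V) (lam : ℝ) (U : Finset V)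
    (L : Set (Sym2 V)) (e : Sym2 V) : ℝ :=
  if e ∈ (restrict G U).edgeSet then if e ∈ L then lam else 1 else 0

/-- The numerator `m_s(U, L) + lam * m_w(U, L)` of the score. -/
noncomputable def totalWeight {V : Type*} (G : SimpleGraph V) (lam : ℝ) (U : Finset V)
    (L : Set (Sym2 V)) : ℝ :=
  mStrong G U L + lam * mWeak G U L

theorem totalWeight_empty {V : Type*} (G : SimpleGraph V) (lam : ℝ) (L : Set (Sym2 V)) :
    totalWeight G lam ∅ L = 0 := by
  have hbot : restrict G ∅ = ⊥ := by ext; simp [restrict]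
  simp [totalWeight, mStrong, mWeak, hbot]

theorem sum_val_lt_succ {R : Type*} [AddCommMonoid R] {m : ℕ} (f : Fin m → R) (e : Fin m) :
    ∑ i with i.val < e.val + 1, f i = f e + ∑ i with i.val < e.val, f i := by
  have split : Finset.univ.filter (fun i : Fin m => i.val < e.val + 1) =
      insert e (Finset.univ.filter fun i : Fin m => i.val < e.val) := by
    ext i
    simp only [Finset.mem_filter_univ, Finset.mem_insert, Fin.ext_iff]
    omega
  rw [split, Finset.sum_insert (by simp)]

section EdgeList

variable {n m : ℕ} {G : SimpleGraph (Fin n)} (E : EdgeList G m)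

namespace EdgeList

theorem edge_injective : Function.Injective E.edge := E.injective

theorem edge_mem (e : Fin m) : E.edge e ∈ G.edgeSet := E.range_eq ▸ Set.mem_range_self e

theorem src_ne_dst (e : Fin m) : E.src e ≠ E.dst e :=
  SimpleGraph.Adj.ne (G := G) (E.edge_mem e)

theorem mem_edge {e : Fin m} {v : Fin n} : v ∈ E.edge e ↔ v = E.src e ∨ v = E.dst e := Sym2.mem_iff

theorem forall_mem_edge {e : Fin m} {P : Fin n → Prop} :
    (∀ v ∈ E.edge e, P v) ↔ P (E.src e) ∧ P (E.dst e) := Sym2.ball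

theorem exists_edge_eq {a : Sym2 (Fin n)} (h : a ∈ G.edgeSet) : ∃ e, E.edge e = a := by
  rwa [← E.range_eq] at h

theorem edge_mem_incidenceSet_restrict (U : Finset (Fin n)) (u : Fin n) (e : Fin m) :
    E.edge e ∈ (restrict G U).incidenceSet u ↔ (∀ v ∈ E.edge e, v ∈ U) ∧ u ∈ E.edge e := by
  rw [SimpleGraph.incidenceSet, Set.mem_sep_iff, mem_restrict_edgeSet]
  simp only [E.edge_mem, true_and]

/-- The set of the first `k` edges of the list. -/
def firstEdges (k : ℕ) : Set (Sym2 (Fin n)) := E.edge '' {e | e.val < k}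

theorem firstEdges_zero : E.firstEdges 0 = ∅ := by simp [firstEdges]

theorem firstEdges_succ (e : Fin m) :
    E.firstEdges (e + 1) = insert (E.edge e) (E.firstEdges e) := by
  have split : {i : Fin m | i.val < e.val + 1} = insert e {i : Fin m | i.val < e.val} := by
    ext i
    simp only [Set.mem_ofPred_eq, Set.mem_insert_iff, Fin.ext_iff]
    omega
  rw [firstEdges, split, Set.image_insert_eq, firstEdges]

theorem edge_notMem_firstEdges (e : Fin m) : E.edge e ∉ E.firstEdges e := by
  simp [firstEdges, E.edge_injective.eq_iff]

theorem firstEdges_self : E.firstEdges m = G.edgeSet := by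
  rw [firstEdges, Set.eq_univ_of_forall (s := {e : Fin m | e.val < m}) Fin.is_lt, Set.image_univ]
  exact E.range_eq

open Classical in
theorem ncard_eq_sum {S : Set (Sym2 (Fin n))} (hS : S ⊆ G.edgeSet) :
    S.ncard = ∑ e, if E.edge e ∈ S then 1 else 0 := by
  have image_eq : E.edge '' {e | E.edge e ∈ S} = S :=
    Set.image_preimage_eq_of_subset fun a ha => E.exists_edge_eq (hS ha)
  rw [Finset.sum_boole, ← Set.ncard_coe_finset, Finset.coe_filter_univ, Nat.cast_id,
    ← Set.ncard_image_of_injective _ E.edge_injective, image_eq]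

open Classical in
theorem strong_add_weak_eq_sum {S : Set (Sym2 (Fin n))} (hS : S ⊆ G.edgeSet)
    (L : Set (Sym2 (Fin n))) (lam : ℝ) :
    ((S \ L).ncard : ℝ) + lam * ((S ∩ L).ncard : ℝ) =
      ∑ e, if E.edge e ∈ S then if E.edge e ∈ L then lam else 1 else 0 := by
  rw [E.ncard_eq_sum (Set.sdiff_subset.trans hS), E.ncard_eq_sum (Set.inter_subset_left.trans hS)]
  push_cast
  rw [Finset.mul_sum, ← Finset.sum_add_distrib]
  refine Finset.sum_congr rfl fun e _ => ?_
  by_cases hmem : E.edge e ∈ S <;> by_cases hweak : E.edge e ∈ L <;> simp [hmem, hweak]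

open Classical in
theorem weightedDegree_eq_sum (lam : ℝ) (U : Finset (Fin n)) (L : Set (Sym2 (Fin n))) (v : Fin n) :
    weightedDegree G lam U L v =
      ∑ e, if v ∈ E.edge e then edgeWeight G lam U L (E.edge e) else 0 := by
  rw [weightedDegree,
    E.strong_add_weak_eq_sum fun a ha => ((mem_restrict_edgeSet G U a).1 ha.1).1]
  refine Finset.sum_congr rfl fun e _ => ?_
  simp only [edgeWeight, E.edge_mem_incidenceSet_restrict, mem_restrict_edgeSet, E.edge_mem,
    true_and, and_comm (b := v ∈ E.edge e), ite_and]

theorem totalWeight_eq_sum (lam : ℝ) (U : Finset (Fin n)) (L : Set (Sym2 (Fin n))) :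
    totalWeight G lam U L = ∑ e, edgeWeight G lam U L (E.edge e) :=
  E.strong_add_weak_eq_sum (fun a ha => ((mem_restrict_edgeSet G U a).1 ha).1) L lam

theorem weightedDegree_eq_zero {v : Fin n} (hv : ∀ e, v ∉ E.edge e) (lam : ℝ) (U : Finset (Fin n))
    (L : Set (Sym2 (Fin n))) : weightedDegree G lam U L v = 0 := by
  simp [E.weightedDegree_eq_sum, hv]

end EdgeList

/-- The array `p` stores the matching `M` of the wedge graph: cell `e` is the index of the partner
of the edge with index `e` plus one, or zero if it has no partner. -/
structure StoresMatching (M : Set (Sym2 (Sym2 (Fin n)))) (p : ℕ → ℕ) : Prop where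
  subset : M ⊆ (wedgeGraph G).edgeSet
  mem_iff : ∀ e f : Fin m, s(E.edge e, E.edge f) ∈ M ↔ p e = f + 1
  exists_partner : ∀ e : Fin m, p e ≠ 0 → ∃ f : Fin m, p e = f + 1

namespace StoresMatching

variable {E} {M : Set (Sym2 (Sym2 (Fin n)))} {p : ℕ → ℕ}

theorem covered_iff (h : StoresMatching E M p) (e : Fin m) : Covered M (E.edge e) ↔ p e ≠ 0 := by
  rw [covered_iff_exists_partner]
  constructor
  · rintro ⟨a, ha⟩
    obtain ⟨f, rfl⟩ := E.exists_edge_eq (mem_edgeSet_of_wedgeGraph_adj (h.subset ha).symm)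
    simp [(h.mem_iff e f).1 ha]
  · intro he
    obtain ⟨f, hf⟩ := h.exists_partner e he
    exact ⟨E.edge f, (h.mem_iff e f).2 hf⟩

theorem symm (h : StoresMatching E M p) {e f : Fin m} (hef : p e = f + 1) : p f = e + 1 := by
  rwa [← h.mem_iff f e, Sym2.eq_swap, h.mem_iff e f]

theorem empty (hp : ∀ e : Fin m, p e = 0) : StoresMatching E ∅ p where
  subset := Set.empty_subset _
  mem_iff e f := by simp [hp e]
  exists_partner e he := absurd (hp e) he

theorem insert (h : StoresMatching E M p) {b t : Fin m} (hb : p b = 0) (ht : p t = 0)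
    (hbt : (wedgeGraph G).Adj (E.edge b) (E.edge t)) :
    StoresMatching E (insert s(E.edge b, E.edge t) M)
      (Function.update (Function.update p b (t + 1)) t (b + 1)) where
  subset := Set.insert_subset hbt h.subset
  mem_iff e f := by
    have hne : b ≠ t := fun hc => hbt.ne (hc ▸ rfl)
    rw [Set.mem_insert_iff, h.mem_iff, Sym2.eq_iff]
    simp only [E.edge_injective.eq_iff, Function.update_apply, Fin.val_inj]
    rcases eq_or_ne e t with rfl | het
    · simp [ht, hne.symm, Fin.ext_iff, eq_comm]
    rcases eq_or_ne e b with rfl | heb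
    · simp [hb, hne, Fin.ext_iff, eq_comm]
    · simp [het, heb]
  exists_partner e he := by
    simp only [Function.update_apply] at he ⊢
    split_ifs at he ⊢
    exacts [⟨b, rfl⟩, ⟨t, rfl⟩, h.exists_partner e he]

theorem erase (h : StoresMatching E M p) {a b : Fin m} (hab : p a = b + 1) :
    StoresMatching E (M \ {s(E.edge a, E.edge b)})
      (Function.update (Function.update p a 0) b 0) where
  subset := Set.sdiff_subset.trans h.subset
  mem_iff e f := by
    have hba := h.symm hab
    rw [Set.mem_sdiff, Set.mem_singleton_iff, h.mem_iff, Sym2.eq_iff]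
    simp only [E.edge_injective.eq_iff, Function.update_apply, Fin.val_inj]
    rcases eq_or_ne e b with rfl | heb
    · simp +contextual [hba, Fin.ext_iff, eq_comm]
    rcases eq_or_ne e a with rfl | hea
    · simp [hab, heb, Fin.ext_iff, eq_comm]
    · simp [hea, heb]
  exists_partner e he := by
    simp only [Function.update_apply] at he ⊢
    split_ifs at he ⊢
    exacts [absurd rfl he, absurd rfl he, h.exists_partner e he]

end StoresMatching

end EdgeList

end STC

/- The word arrays `SIZE` to `LABEL` and the real arrays `LAM` and `PRIO` are those fixed by
`inputState`, `Represents` and `IsOutput`. `TIME` holds for each deleted vertex the number of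
vertices just before its deletion, so that a vertex belongs to the `U` with `k` vertices iff it has
not been deleted or its time is at most `k`. `STACK` lists the remaining vertices on no edge of the
input and `HEIGHT` counts them. `TOUCHED` and `MATRIX` (an adjacency matrix) are used by the
initialization. -/
local notation "SIZE" => 0
local notation "SRC" => 1
local notation "DST" => 2
local notation "COUNT" => 3
local notation "VERT" => 4
local notation "EDGE" => 5
local notation "PARTNER" => 6
local notation "START" => 7
local notation "LENGTH" => 8
local notation "LIST" => 9
local notation "OUT" => 10
local notation "LABEL" => 11
local notation "TIME" => 12
local notation "STACK" => 13
local notation "HEIGHT" => 14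
local notation "TOUCHED" => 15
local notation "MATRIX" => 16
local notation "OUTER" => 17
local notation "INNER" => 18
local notation "CHOSEN" => 19
local notation "CURRENT" => 20
local notation "FOUND" => 21
local notation "BESTCARD" => 22
local notation "LAM" => 0
local notation "PRIO" => 1
local notation "TOTAL" => 2
local notation "BEST" => 3
local notation "WEIGHT" => 4

/-! ## Memory -/

namespace STC

open RAM

section Storage

variable {n m : ℕ} {G : SimpleGraph (Fin n)} (E : EdgeList G m) (lam : ℝ) (U : Finset (Fin n))

/-- The memory holds the input. -/
structure HasInput (s : State) : Prop where
  n_eq : s.ints SIZE 0 = n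
  m_eq : s.ints SIZE 1 = m
  src : ∀ e : Fin m, s.ints SRC e = E.src e
  dst : ∀ e : Fin m, s.ints DST e = E.dst e
  lam_eq : s.reals LAM 0 = lam

/-- The memory holds the input, the indicator of `E(U)` and the adjacency lists of the wedge graph
of the input graph, from which those of the wedge graph of `(U, E(U))` arise by skipping the edges
outside `E(U)`. -/
structure StoresGraph (s : State) : Prop extends HasInput E lam s where
  edges : ∀ e : Fin m, s.ints EDGE e = if E.src e ∈ U ∧ E.dst e ∈ U then 1 else 0
  length_le : ∀ e : Fin m, s.ints LENGTH e ≤ n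
  entry_lt : ∀ e : Fin m, ∀ j < s.ints LENGTH e, s.ints LIST (s.ints START e + j) < m
  adj_iff : ∀ e f : Fin m, (wedgeGraph G).Adj (E.edge e) (E.edge f) ↔
    ∃ j < s.ints LENGTH e, s.ints LIST (s.ints START e + j) = f

variable {E lam U} {s s' : State} {p : Cmd}

theorem HasInput.of_frame (h : HasInput E lam s) (hF : Frame p s s')
    (hI : ∀ a ∈ [SIZE, SRC, DST], p.writesI a = false) (hR : p.writesR LAM = false) :
    HasInput E lam s' := by
  simp only [List.forall_mem_cons] at hI
  obtain ⟨hsize, hsrc, hdst, -⟩ := hI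
  constructor <;> simp only [hF.ints hsize, hF.ints hsrc, hF.ints hdst, hF.reals hR]
  exacts [h.n_eq, h.m_eq, h.src, h.dst, h.lam_eq]

namespace StoresGraph

theorem of_frame (h : StoresGraph E lam U s) (hF : Frame p s s')
    (hI : ∀ a ∈ [SIZE, SRC, DST, EDGE, START, LENGTH, LIST], p.writesI a = false)
    (hR : p.writesR LAM = false) : StoresGraph E lam U s' := by
  have hsubset : [SIZE, SRC, DST] ⊆ [SIZE, SRC, DST, EDGE, START, LENGTH, LIST] := by decide
  have hin := h.toHasInput.of_frame hF (fun a ha => hI a (hsubset ha)) hR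
  simp only [List.forall_mem_cons] at hI
  obtain ⟨-, -, -, hedge, hstart, hlength, hlist, -⟩ := hI
  refine ⟨hin, ?_, ?_, ?_, ?_⟩ <;>
    simp only [hF.ints hedge, hF.ints hstart, hF.ints hlength, hF.ints hlist]
  exacts [h.edges, h.length_le, h.entry_lt, h.adj_iff]

theorem edge_eq_one_iff (h : StoresGraph E lam U s) (e : Fin m) :
    s.ints EDGE e = 1 ↔ ∀ v ∈ E.edge e, v ∈ U := by
  simp [h.edges, E.forall_mem_edge]

theorem edge_mem_restrict_iff (h : StoresGraph E lam U s) (e : Fin m) :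
    E.edge e ∈ (restrict G U).edgeSet ↔ s.ints EDGE e = 1 := by
  rw [mem_restrict_edgeSet, h.edge_eq_one_iff]
  exact and_iff_right (E.edge_mem e)

theorem restrict_adj_iff (h : StoresGraph E lam U s) (e f : Fin m) :
    (wedgeGraph (restrict G U)).Adj (E.edge e) (E.edge f) ↔ s.ints EDGE e = 1 ∧
      s.ints EDGE f = 1 ∧ ∃ j < s.ints LENGTH e, s.ints LIST (s.ints START e + j) = f := by
  rw [wedgeGraph_restrict_adj, h.adj_iff, h.edge_eq_one_iff, h.edge_eq_one_iff]
  tauto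

end StoresGraph

end Storage

/-- The expression for the number of vertices. -/
abbrev nVar : IExp := var SIZE

/-- The expression for the number of edges. -/
abbrev mVar : IExp := .get SIZE (.const 1)

/-! ## The program: priorities -/

/-- Sets the priorities of all vertices that lie on an edge to zero. -/
def clearPriorities : Cmd :=
  forLoop OUTER mVar (.seq (.setR PRIO (.get SRC (var OUTER)) (.ofInt (.const 0)))
    (.setR PRIO (.get DST (var OUTER)) (.ofInt (.const 0))))

/-- Stores the weight of the edge `e`, which is `0` if the edge has been deleted. -/
def loadWeight (e : IExp) : Cmd :=
  .ite (.ieq (.get EDGE e) (.const 1))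
    (.ite (.ieq (.get PARTNER e) (.const 0)) (assignR WEIGHT (.ofInt (.const 1)))
      (assignR WEIGHT (varR LAM)))
    (assignR WEIGHT (.ofInt (.const 0)))

/-- Adds the loaded weight to the priority of the vertex `v`. -/
abbrev addWeight (v : IExp) : Cmd := .setR PRIO v (.add (.get PRIO v) (varR WEIGHT))

/-- Adds the weight of each edge to the priorities of its endpoints and to the total weight. -/
def addWeights : Cmd :=
  forLoop OUTER mVar (.seq (loadWeight (var OUTER))
    (.seq (addWeight (.get SRC (var OUTER))) (.seq (addWeight (.get DST (var OUTER)))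
      (assignR TOTAL (.add (varR TOTAL) (varR WEIGHT))))))

/-- Computes the weighted degrees of all vertices and the total weight from scratch. -/
def computePriorities : Cmd :=
  .seq clearPriorities (.seq (assignR TOTAL (.ofInt (.const 0))) addWeights)

section Priorities

variable {n m W : ℕ} {G : SimpleGraph (Fin n)} {E : EdgeList G m} {lam : ℝ} {U : Finset (Fin n)}
  {M : Set (Sym2 (Sym2 (Fin n)))} {s : State}

theorem wp_loadWeight (hG : StoresGraph E lam U s) (hM : StoresMatching E M (s.ints PARTNER))
    {k : IExp} {e : Fin m} (hk : k.eval s = e) {Q : State → Prop}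
    (hQ : Q (s.setR WEIGHT 0 (edgeWeight G lam U (weakEdges M) (E.edge e)))) :
    (loadWeight k).wp W Q s := by
  have weak : E.edge e ∈ weakEdges M ↔ s.ints PARTNER e ≠ 0 := hM.covered_iff e
  have deleted (h : s.ints EDGE e ≠ 1) : edgeWeight G lam U (weakEdges M) (E.edge e) = 0 := by
    simp [edgeWeight, hG.edge_mem_restrict_iff, h]
  have remaining (h : s.ints EDGE e = 1) : edgeWeight G lam U (weakEdges M) (E.edge e) =
      if s.ints PARTNER e = 0 then 1 else lam := by
    simp [edgeWeight, hG.edge_mem_restrict_iff, h, weak]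
  simp only [loadWeight, Cmd.wp, IExp.eval, RExp.eval, BExp.Holds, hk, hG.lam_eq]
  refine ⟨fun h => ⟨fun h' => ?_, fun h' => ?_⟩, fun h => ?_⟩
  · simpa [remaining h, h'] using hQ
  · simpa [remaining h, h'] using hQ
  · simpa [deleted h] using hQ

theorem runs_clearPriorities (hm : m < W) (hin : HasInput E lam s)
    (h0 : ∀ v : Fin n, (∀ e, v ∉ E.edge e) → s.reals PRIO v = 0) :
    Runs W clearPriorities s (30 * (m + 1)) fun s' => ∀ v : Fin n, s'.reals PRIO v = 0 := by
  refine (Runs.forLoop_wp (fun i s' => ∀ v : Fin n,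
    (∀ e : Fin m, i ≤ e → v ∉ E.edge e) → s'.reals PRIO v = 0) (C := 30) (by decide) hm rfl
    (fun s' hF => by exact (hin.of_frame hF (by decide) rfl).m_eq) ?_ ?_).mono le_rfl ?_
  · simpa using h0
  · intro i s' hi hF hI ha v hv
    have hin' := hin.of_frame hF (by decide) rfl
    lift i to Fin m using hi with e
    by_cases hve : v ∈ E.edge e
    · rcases E.mem_edge.1 hve with rfl | rfl <;>
        simp [RExp.eval, IExp.eval, ha, hin'.src, hin'.dst, Function.update_apply]
    · have hve' := hve
      simp only [E.mem_edge, not_or, Fin.ext_iff] at hve'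
      have := hI v fun f hf => by
        rcases hf.eq_or_lt with h | h
        · rwa [← Fin.ext h]
        · exact hv f h
      simpa [RExp.eval, IExp.eval, ha, hin'.src, hin'.dst, hve'] using this
  · exact fun s' h _ v => h v fun e he => absurd e.is_lt he.not_gt

theorem runs_addWeights (hm : m < W) (hG : StoresGraph E lam U s)
    (hM : StoresMatching E M (s.ints PARTNER)) (h0 : ∀ v : Fin n, s.reals PRIO v = 0)
    (htotal : s.reals TOTAL 0 = 0) :
    Runs W addWeights s (100 * (m + 1)) fun s' =>
      (∀ v : Fin n, s'.reals PRIO v = weightedDegree G lam U (weakEdges M) v) ∧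
      s'.reals TOTAL 0 = totalWeight G lam U (weakEdges M) := by
  set w := fun e => edgeWeight G lam U (weakEdges M) (E.edge e) with hw
  refine (Runs.forLoop_wp (fun i s' =>
    (∀ v : Fin n, s'.reals PRIO v = ∑ e with e.val < i, if v ∈ E.edge e then w e else 0) ∧
      s'.reals TOTAL 0 = ∑ e with e.val < i, w e) (C := 100) (by decide) hm rfl
    (fun s' hF => by exact (hG.of_frame hF (by decide) rfl).m_eq) ?_ ?_).mono le_rfl ?_
  · simpa using ⟨h0, htotal⟩
  · rintro i s' hi hF ⟨hprio, htot⟩ ha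
    have hG' := hG.of_frame hF (by decide) rfl
    lift i to Fin m using hi with e
    refine wp_loadWeight hG' (by rwa [hF.ints rfl]) (by simpa [IExp.eval]) ⟨fun v => ?_, ?_⟩
    · rw [sum_val_lt_succ, ← hprio v]
      have hne : (E.src e : ℕ) ≠ E.dst e := Fin.val_ne_of_ne (E.src_ne_dst e)
      by_cases hsrc : v = E.src e
      · simp [RExp.eval, IExp.eval, ha, hG'.src, hG'.dst, E.mem_edge, hsrc, hne, hw, add_comm]
      by_cases hdst : v = E.dst e
      · simp [RExp.eval, IExp.eval, ha, hG'.src, hG'.dst, E.mem_edge, hdst, hne.symm, hw, add_comm]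
      · simp [RExp.eval, IExp.eval, ha, hG'.src, hG'.dst, E.mem_edge, hsrc, hdst, Fin.val_inj]
    · rw [sum_val_lt_succ, ← htot]
      simp [RExp.eval, IExp.eval, hw, add_comm]
  · rintro s' ⟨hprio, htot⟩ -
    simp only [E.weightedDegree_eq_sum, E.totalWeight_eq_sum]
    simpa [hw] using And.intro hprio htot

theorem runs_computePriorities (hm : m < W) (hG : StoresGraph E lam U s)
    (hM : StoresMatching E M (s.ints PARTNER))
    (h0 : ∀ v : Fin n, (∀ e, v ∉ E.edge e) → s.reals PRIO v = 0) :
    Runs W computePriorities s (140 * (m + 1)) fun s' =>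
      (∀ v : Fin n, s'.reals PRIO v = weightedDegree G lam U (weakEdges M) v) ∧
      s'.reals TOTAL 0 = totalWeight G lam U (weakEdges M) := by
  refine (Runs.seq (runs_clearPriorities hm hG.toHasInput h0) fun s₁ hs₁ hF₁ =>
    Runs.seq (.of_wp (Q := fun s₂ => s₂ = s₁.setR TOTAL 0 0)
      (by simp [Cmd.wp, IExp.eval, RExp.eval])) fun s₂ hs₂ hF₂ =>
    runs_addWeights hm ((hG.of_frame hF₁ (by decide) rfl).of_frame hF₂ (by decide) rfl)
      (by rwa [hF₂.ints rfl, hF₁.ints rfl]) (by simpa [hs₂] using hs₁)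
      (by simp [hs₂])).mono_time ?_
  simp only [Cmd.loopFreeCost, IExp.cost, RExp.cost]
  omega

end Priorities

end STC

/-! ## The program: the matching -/

namespace STC

open RAM

section TryMatch

variable {α : Type*} {Z Z' : SimpleGraph α} {N P : Set α} {M M' M'' : Set (Sym2 α)} {a b : α}

/-- `M'` is a possible result of the attempt to match the node `b` to an unmatched neighbour. -/
inductive TryMatch (Z : SimpleGraph α) (b : α) (M : Set (Sym2 α)) : Set (Sym2 α) → Prop
  | matched (t : α) : Z.Adj b t → ¬ Covered M t → TryMatch Z b M (insert s(b, t) M)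
  | stuck : (∀ t, Z.Adj b t → Covered M t) → TryMatch Z b M M

theorem AprReach.tryMatch (h : AprReach Z M) (hb : ¬ Covered M b) (hM : TryMatch Z b M M') :
    AprReach Z M' := by
  cases hM with
  | matched t hbt ht => exact .pick M b t h hbt hb ht
  | stuck => exact h

theorem TryMatch.covers_insert (hM : TryMatch Z b M M')
    (h : ∀ a ∈ P, ∀ c, Z.Adj a c → Covered M a ∨ Covered M c) :
    ∀ a ∈ insert b P, ∀ c, Z.Adj a c → Covered M' a ∨ Covered M' c := by
  rintro a (rfl | ha) c hac <;> cases hM with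
  | matched t => simp only [covered_insert]; grind
  | stuck hstuck => grind

theorem TryMatch.dynStep (hM : TryMatch Z' b (M \ {s(a, b)}) M') (hZ : IsDeletion Z N Z')
    (hab : s(a, b) ∈ M) : DynStep Z' N a M M' := by
  cases hM with
  | matched t hbt ht => exact .replace b t hab ⟨hZ.not_mem hbt, hZ.not_mem hbt.symm, ht, hbt⟩
  | stuck hstuck => exact .drop b hab fun ⟨t, _, _, ht, hbt⟩ => ht (hstuck t hbt)

theorem TryMatch.subset_edgeSet (hM : TryMatch Z b M M') (h : M ⊆ Z'.edgeSet)
    (hZ : Z ≤ Z') : M' ⊆ Z'.edgeSet := by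
  cases hM with
  | matched t hbt => exact Set.insert_subset (hZ hbt) h
  | stuck => exact h

theorem DynUpdated.inter_insert (h : DynUpdated Z N (N ∩ P) M M') (ha : a ∉ P)
    (hmem : a ∈ N → DynStep Z N a M' M'') (hnotMem : a ∉ N → M'' = M') :
    DynUpdated Z N (N ∩ insert a P) M M'' := by
  by_cases haN : a ∈ N
  · rw [Set.inter_insert_of_mem haN]
    exact h.insert (fun hc => ha hc.2) (hmem haN)
  · rwa [Set.inter_insert_of_notMem haN, hnotMem haN]

end TryMatch

/-- The entry of the adjacency list of the edge in `CURRENT` that the inner loop inspects. -/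
abbrev entry : IExp := .get LIST (.add (.get START (var CURRENT)) (var INNER))

/-- Looks for a remaining unmatched neighbour of the edge in `CURRENT` and stores its index plus one
in `FOUND`, or zero if there is none. -/
def search : Cmd :=
  .seq (assign FOUND (.const 0)) (forLoop INNER (.get LENGTH (var CURRENT))
    (.ite (.and (.ieq (.get EDGE entry) (.const 1)) (.ieq (.get PARTNER entry) (.const 0)))
      (assign FOUND (.add entry (.const 1))) .skip))

/-- Matches the edge in `CURRENT` to a remaining unmatched neighbour, if there is one. -/
def tryMatch : Cmd :=
  .seq search (.ite (.and (.ieq (.get EDGE (var CURRENT)) (.const 1))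
    (.not (.ieq (var FOUND) (.const 0))))
    (.seq (.setI PARTNER (var CURRENT) (var FOUND))
      (.setI PARTNER (.sub (var FOUND) (.const 1)) (.add (var CURRENT) (.const 1)))) .skip)

/-- Computes a maximal matching of the wedge graph. -/
def initMatching : Cmd :=
  forLoop OUTER mVar (.ite (.ieq (.get PARTNER (var OUTER)) (.const 0))
    (.seq (assign CURRENT (var OUTER)) tryMatch) .skip)

/-- The vertex `v` is an endpoint of the edge `e`. -/
abbrev isEnd (e v : IExp) : BExp :=
  .not (.and (.not (.ieq (.get SRC e) v)) (.not (.ieq (.get DST e) v)))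

/-- Removes the pair of the edge in `OUTER` from the matching and moves its partner to `CURRENT`. -/
def unmatch : Cmd :=
  .seq (assign CURRENT (.sub (.get PARTNER (var OUTER)) (.const 1)))
    (.seq (.setI PARTNER (var OUTER) (.const 0)) (.setI PARTNER (var CURRENT) (.const 0)))

/-- Replaces the pair of the edge in `OUTER`, if that edge has been deleted together with the vertex
in `CHOSEN`. -/
def rematch : Cmd :=
  .ite (.and (isEnd (var OUTER) (var CHOSEN)) (.not (.ieq (.get PARTNER (var OUTER)) (.const 0))))
    (.seq unmatch tryMatch) .skip

/-- Updates the matching after the deletion of the vertex in `CHOSEN`. -/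
def updateMatching : Cmd := forLoop OUTER mVar rematch

section MatchingProgram

variable {n m W : ℕ} {G : SimpleGraph (Fin n)} {E : EdgeList G m} {lam : ℝ} {U : Finset (Fin n)}
  {M : Set (Sym2 (Sym2 (Fin n)))} {s : State} {u : Fin n} {b e : Fin m}

theorem runs_search (hmW : m < W) (hnW : n < W) (hG : StoresGraph E lam U s)
    (hb : s.ints CURRENT 0 = b) {item : ℕ → ℕ}
    (hitem : ∀ j, s.ints LIST (s.ints START b + j) = item j) {free : ℕ → Prop}
    (hfree : ∀ t, free t ↔ s.ints EDGE t = 1 ∧ s.ints PARTNER t = 0) :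
    Runs W search s (70 * (n + 1)) fun s' =>
      (s'.ints FOUND 0 = 0 ∧ ∀ j < s.ints LENGTH b, ¬ free (item j)) ∨
      ∃ j < s.ints LENGTH b, free (item j) ∧ s'.ints FOUND 0 = item j + 1 := by
  have hlen := hG.length_le b
  refine (Runs.seq (T' := 60 * (s.ints LENGTH b + 1)) (.of_wp (Q := fun s' => s' = s.setI FOUND 0 0)
    (by simp [Cmd.wp, IExp.eval, Nat.zero_lt_of_lt hmW])) ?_).mono_time ?_
  · rintro s₁ rfl -
    refine Runs.forLoop_wp (fun i s' => (s'.ints FOUND 0 = 0 ∧ ∀ j < i, ¬ free (item j)) ∨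
      ∃ j < i, free (item j) ∧ s'.ints FOUND 0 = item j + 1)
      (by decide) (hlen.trans_lt hnW) rfl (fun s' hF => ?_) (by simp) fun i s' hi hF hI ha => ?_
    · simp [IExp.eval, hF.ints (a := LENGTH) rfl, hF.ints (a := CURRENT) rfl, hb]
    have hent := hitem i ▸ hG.entry_lt b i hi
    simp only [Cmd.wp, IExp.eval, BExp.Holds, ha, hF.ints (a := EDGE) rfl,
      hF.ints (a := PARTNER) rfl, hF.ints (a := START) rfl, hF.ints (a := LIST) rfl,
      hF.ints (a := CURRENT) rfl, State.setI_ints, hb, hitem, Nat.reduceEqDiff, reduceIte,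
      Function.update_self, ← hfree]
    refine ⟨fun h => ⟨by omega, Or.inr ⟨i, i.lt_succ_self, h, rfl⟩⟩, fun h => hI.imp ?_ ?_⟩
    · exact fun ⟨h0, hI⟩ => ⟨h0, Nat.forall_lt_succ_right.2 ⟨hI, h⟩⟩
    · exact fun ⟨j, hj, hI⟩ => ⟨j, hj.trans i.lt_succ_self, hI⟩
  · simp only [Cmd.loopFreeCost, IExp.cost]
    omega

theorem runs_tryMatch (hmW : m < W) (hnW : n < W) (hG : StoresGraph E lam U s)
    (hM : StoresMatching E M (s.ints PARTNER)) (hb : s.ints CURRENT 0 = b)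
    (hfree : s.ints PARTNER b = 0) :
    Runs W tryMatch s (100 * (n + 1)) fun s' => ∃ M', StoresMatching E M' (s'.ints PARTNER) ∧
      TryMatch (wedgeGraph (restrict G U)) (E.edge b) M M' := by
  refine (Runs.seq (runs_search hmW hnW hG hb (fun _ => rfl) fun _ => Iff.rfl)
    fun s₁ h₁ hF => .of_wp ?_).mono_time ?_
  · have := b.is_lt
    simp only [Cmd.wp, IExp.eval, BExp.Holds, hF.ints (a := EDGE) rfl, hF.ints (a := PARTNER) rfl,
      hF.ints (a := CURRENT) rfl, hb, State.setI_ints, Nat.reduceEqDiff, reduceIte]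
    refine ⟨?_, fun h => ⟨M, hM, .stuck fun t ht => ?_⟩⟩
    · rintro ⟨hedge, hfound⟩
      obtain ⟨j, hj, ⟨htU, htM⟩, hfound⟩ := h₁.resolve_left fun h => hfound h.1
      lift s.ints LIST (s.ints START b + j) to Fin m using hG.entry_lt b j hj with t ht
      have hadj := (hG.restrict_adj_iff b t).2 ⟨hedge, htU, j, hj, ht.symm⟩
      rw [hfound]
      exact ⟨by omega, by omega, _,
        hM.insert hfree htM ((wedgeGraph_restrict_adj _ _ _ _).1 hadj).1,
        .matched _ hadj (by simp [hM.covered_iff, htM])⟩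
    · obtain ⟨f, rfl⟩ := E.exists_edge_eq
        (mem_edgeSet_of_wedgeGraph_adj ((wedgeGraph_restrict_adj _ _ _ _).1 ht).1.symm)
      obtain ⟨hedge, hf, j, hj, hjf⟩ := (hG.restrict_adj_iff b f).1 ht
      rw [hM.covered_iff, ← hjf]
      rcases h₁ with ⟨-, h₁⟩ | ⟨_, -, -, hfound⟩
      · exact fun hf' => h₁ j hj ⟨hjf ▸ hf, hf'⟩
      · exact absurd ⟨hedge, by omega⟩ h
  · simp only [Cmd.loopFreeCost, IExp.cost, BExp.cost]
    omega

theorem runs_initMatching (hmW : m < W) (hnW : n < W) (hG : StoresGraph E lam Finset.univ s)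
    (hp : ∀ e : Fin m, s.ints PARTNER e = 0) :
    Runs W initMatching s ((100 * (n + 1) + 40) * (m + 1)) fun s' =>
      ∃ M, AprMatching (wedgeGraph G) M ∧ StoresMatching E M (s'.ints PARTNER) := by
  refine (Runs.forLoop_const (T := 100 * (n + 1) + 12) (fun i s' => ∃ M, AprReach (wedgeGraph G) M ∧
    StoresMatching E M (s'.ints PARTNER) ∧ ∀ a ∈ E.firstEdges i, ∀ c, (wedgeGraph G).Adj a c →
      Covered M a ∨ Covered M c) (by simp [IExp.cost]) hmW rfl
    (fun s' hF => by exact (hG.of_frame hF (by decide) rfl).m_eq)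
    ⟨∅, .empty, .empty (by simpa using hp), by simp [E.firstEdges_zero]⟩ ?_).mono le_rfl ?_
  · rintro i s' hi hF ⟨M, hR, hM, hcov⟩ ha
    have hG' := hG.of_frame hF (by decide) rfl
    lift i to Fin m using hi with e
    simp only [E.firstEdges_succ, State.setI_ints, Nat.reduceEqDiff, reduceIte]
    refine (Runs.ite (T := 100 * (n + 1) + 4) (fun h => ?_) fun h => ?_).mono_time
      (by simp only [BExp.cost, IExp.cost]; omega)
    · simp only [BExp.Holds, IExp.eval, ha] at h
      refine (Runs.seq (.of_wp (Q := fun s'' => s'' = s'.setI CURRENT 0 e) ?_)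
        fun s₁ hs₁ hF₁ => (runs_tryMatch (b := e) hmW hnW (hG'.of_frame hF₁ (by decide) rfl)
          (by rwa [hF₁.ints rfl]) (by simp [hs₁]) (by rwa [hF₁.ints rfl])).mono le_rfl ?_).mono_time
        (by simp only [Cmd.loopFreeCost, IExp.cost]; omega)
      · simpa [Cmd.wp, IExp.eval, ha] using e.is_lt.trans hmW
      · rw [restrict_univ]
        rintro s₂ ⟨M', hM', htry⟩ -
        exact ⟨M', hR.tryMatch (by simpa [hM.covered_iff]) htry, hM', htry.covers_insert hcov⟩
    · simp only [BExp.Holds, IExp.eval, ha] at h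
      refine (Runs.of_wp (p := .skip) ?_).mono_time (by simp [Cmd.loopFreeCost])
      refine ⟨M, hR, hM, ?_⟩
      rintro a (rfl | ha) c hac
      exacts [Or.inl ((hM.covered_iff e).2 h), hcov a ha c hac]
  · rintro s' ⟨M, hR, hM, hcov⟩ -
    rw [E.firstEdges_self] at hcov
    refine ⟨M, ⟨hR, ?_⟩, hM⟩
    rintro ⟨a, b, hab, ha, hb⟩
    exact (hcov a (mem_edgeSet_of_wedgeGraph_adj hab) b hab).elim ha hb

theorem HasInput.isEnd_holds (h : HasInput E lam s) {k l : IExp} (hk : k.eval s = e)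
    (hl : l.eval s = u) : (isEnd k l).Holds s ↔ u ∈ E.edge e := by
  simp only [BExp.Holds, IExp.eval, hk, hl, h.src, h.dst, E.mem_edge, Fin.val_inj, not_and_or,
    not_not, eq_comm]

theorem runs_unmatch (hmW : m < W) (he : s.ints OUTER 0 = e) (hb : s.ints PARTNER e = b + 1) :
    Runs W unmatch s 20 fun s' => s'.ints CURRENT 0 = b ∧
      s'.ints PARTNER = Function.update (Function.update (s.ints PARTNER) e 0) b 0 := by
  refine (Runs.of_wp ?_).mono_time (by decide)
  simp [unmatch, Cmd.wp, IExp.eval, he, hb, b.is_lt.trans hmW, Nat.zero_lt_of_lt hmW]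

theorem runs_rematch (hmW : m < W) (hnW : n < W) (hG : StoresGraph E lam (U.erase u) s)
    (hu : s.ints CHOSEN 0 = u) (he : s.ints OUTER 0 = e)
    (hM : StoresMatching E M (s.ints PARTNER)) (hMU : M ⊆ (wedgeGraph (restrict G U)).edgeSet) :
    Runs W rematch s (60 + if u ∈ E.edge e then 100 * (n + 1) else 0) fun s' => ∃ M',
      StoresMatching E M' (s'.ints PARTNER) ∧ M' ⊆ (wedgeGraph (restrict G U)).edgeSet ∧
      (E.edge e ∈ (restrict G U).incidenceSet u → DynStep (wedgeGraph (restrict G (U.erase u)))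
        ((restrict G U).incidenceSet u) (E.edge e) M M') ∧
      (E.edge e ∉ (restrict G U).incidenceSet u → M' = M) := by
  have hZ := isDeletion_wedgeGraph_erase G U u
  have hend : (isEnd (var OUTER) (var CHOSEN)).Holds s ↔ u ∈ E.edge e := hG.isEnd_holds he hu
  by_cases hc : u ∈ E.edge e ∧ s.ints PARTNER e ≠ 0
  · refine (Runs.ite (T := 20 + 100 * (n + 1)) (fun _ => ?_) fun h => ?_).mono_time
      (by simp only [BExp.cost, IExp.cost, hc.1, if_true]; omega)
    · obtain ⟨b, hb⟩ := hM.exists_partner e hc.2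
      have hab := (hM.mem_iff e b).2 hb
      have hincident : E.edge e ∈ (restrict G U).incidenceSet u :=
        (E.edge_mem_incidenceSet_restrict U u e).2
          ⟨((wedgeGraph_restrict_adj _ _ _ _).1 (hMU hab)).2.1, hc.1⟩
      refine (runs_unmatch hmW he hb).seq fun s₁ ⟨hcur, hpart⟩ hF₁ =>
        (runs_tryMatch hmW hnW (hG.of_frame hF₁ (by decide) rfl) (by rw [hpart]; exact hM.erase hb)
          hcur (by simp [hpart])).mono le_rfl ?_
      rintro s₂ ⟨M', hM', htry⟩ -
      have hsubset := htry.subset_edgeSet (Set.sdiff_subset.trans hMU) fun a c h => ((hZ a c).1 h).1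
      exact ⟨M', hM', hsubset, fun _ => htry.dynStep hZ hab, absurd hincident⟩
    · exact absurd ⟨hend.2 hc.1, by simpa [BExp.Holds, IExp.eval, he] using hc.2⟩ h
  · refine (Runs.ite (T := 1) (fun h => ?_) fun _ => .of_wp (p := .skip) ?_).mono_time
      (by simp only [BExp.cost, IExp.cost]; omega)
    · exact absurd ⟨hend.1 h.1, by simpa [BExp.Holds, IExp.eval, he] using h.2⟩ hc
    · refine ⟨M, hM, hMU, fun hincident => .unmatched fun hb => hc ?_, fun _ => rfl⟩
      exact ⟨((E.edge_mem_incidenceSet_restrict U u e).1 hincident).2,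
        (hM.covered_iff e).1 (covered_iff_exists_partner.2 hb)⟩

theorem runs_updateMatching (hmW : m < W) (hnW : n < W) (hG : StoresGraph E lam (U.erase u) s)
    (hu : s.ints CHOSEN 0 = u) (hM : StoresMatching E M (s.ints PARTNER))
    (hMU : M ⊆ (wedgeGraph (restrict G U)).edgeSet) :
    Runs W updateMatching s
      (80 * (m + 1) + Finset.card {e | u ∈ E.edge e} * (100 * (n + 1))) fun s' =>
      ∃ M', DynamicVertexCover (wedgeGraph (restrict G (U.erase u)))
        ((restrict G U).incidenceSet u) M M' ∧ StoresMatching E M' (s'.ints PARTNER) := by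
  refine (Runs.forLoop (fun i s' => ∃ M', DynUpdated (wedgeGraph (restrict G (U.erase u)))
      ((restrict G U).incidenceSet u) ((restrict G U).incidenceSet u ∩ E.firstEdges i) M M' ∧
      M' ⊆ (wedgeGraph (restrict G U)).edgeSet ∧ StoresMatching E M' (s'.ints PARTNER))
    (fun i => 60 + if s.ints SRC i = u ∨ s.ints DST i = u then 100 * (n + 1) else 0) hmW rfl
    (fun s' hF => by exact (hG.of_frame hF (by decide) rfl).m_eq)
    ⟨M, by simpa [E.firstEdges_zero] using .empty _ _ M, hMU, by simpa⟩ ?_).mono ?_ ?_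
  · rintro i s' hi hF ⟨M₁, hP, hM₁U, hM₁⟩ ha
    have hG' := hG.of_frame hF (by decide) rfl
    lift i to Fin m using hi with e
    refine (runs_rematch hmW hnW hG' (by rwa [hF.ints rfl]) ha hM₁ hM₁U).mono ?_ ?_
    · simp only [hG.src, hG.dst, Fin.val_inj, E.mem_edge, eq_comm, le_rfl]
    · rintro s'' ⟨M₂, hM₂, hM₂U, hmem, hnotMem⟩ -
      rw [E.firstEdges_succ]
      exact ⟨M₂, hP.inter_insert (E.edge_notMem_firstEdges e) hmem hnotMem, hM₂U, by simpa⟩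
  · rw [Finset.sum_range]
    simp only [hG.src, hG.dst, Fin.val_inj, eq_comm (b := u), ← E.mem_edge, Finset.sum_add_distrib,
      ← Finset.sum_filter, Finset.sum_const, Finset.card_univ, Fintype.card_fin, smul_eq_mul,
      IExp.cost]
    omega
  · rintro s' ⟨M', hP, -, hM'⟩ -
    have hincident : (restrict G U).incidenceSet u ⊆ E.firstEdges m := fun a ha => by
      rw [E.firstEdges_self]
      exact ((mem_restrict_edgeSet G U a).1 ha.1).1
    rw [Set.inter_eq_left.2 hincident] at hP
    exact ⟨M', hP, hM'⟩

end MatchingProgram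

end STC

/-! ## The program: a pass of the main loop -/

namespace STC

open RAM

/-- The first `k` cells of the array `f` list, each once, the vertices in `U` that are on no edge of
the input graph. -/
def IsolatedStack {n m : ℕ} {G : SimpleGraph (Fin n)} (E : EdgeList G m) (U : Finset (Fin n))
    (k : ℕ) (f : ℕ → ℕ) : Prop :=
  Set.BijOn f (Set.Iio k) (Fin.val '' {v | v ∈ U ∧ ∀ e, v ∉ E.edge e})

/-- The vertex `v` is the last of the first `k` cells of the array `f`. -/
def IsTop {n : ℕ} (k : ℕ) (f : ℕ → ℕ) (v : Fin n) : Prop := 0 < k ∧ f (k - 1) = v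

/-- The memory holds the data that Greedy maintains, for the vertex set `U` and the matching `M`. -/
structure Maintains {n m : ℕ} {G : SimpleGraph (Fin n)} (E : EdgeList G m) (lam : ℝ)
    (U : Finset (Fin n)) (M : Set (Sym2 (Sym2 (Fin n)))) (s : State) : Prop
    extends StoresGraph E lam U s where
  count : s.ints COUNT 0 = U.card
  vertices : ∀ v : Fin n, s.ints VERT v = if v ∈ U then 1 else 0
  matching : StoresMatching E M (s.ints PARTNER)
  priority : ∀ v : Fin n, s.reals PRIO v = weightedDegree G lam U (weakEdges M) v
  total : s.reals TOTAL 0 = totalWeight G lam U (weakEdges M)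

/-- The memory holds the cardinality, the total weight and the labeling of the pair with the largest
score so far. -/
structure Remembers {n m : ℕ} {G : SimpleGraph (Fin n)} (E : EdgeList G m) (lam : ℝ)
    (U : Finset (Fin n)) (M : Set (Sym2 (Sym2 (Fin n)))) (s : State) : Prop where
  card : s.ints BESTCARD 0 = U.card
  total : s.reals BEST 0 = totalWeight G lam U (weakEdges M)
  weak : ∀ e : Fin m, E.edge e ∈ weakEdges M → s.ints LABEL e = 1
  strong : ∀ e : Fin m, E.edge e ∉ weakEdges M → s.ints LABEL e = 0

/-- The effect of `record`; the scores are compared without division, so that the memory may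
initially remember the empty set. -/
def Recorded {n m : ℕ} {G : SimpleGraph (Fin n)} (E : EdgeList G m) (lam : ℝ)
    (U : Finset (Fin n)) (M : Set (Sym2 (Sym2 (Fin n)))) (s s' : State) : Prop :=
  ∀ U' M', Remembers E lam U' M' s →
    if totalWeight G lam U (weakEdges M) * U'.card < totalWeight G lam U' (weakEdges M') * U.card
    then Remembers E lam U' M' s' else Remembers E lam U M s'

/-- Stores the current labels. -/
def copyLabels : Cmd :=
  forLoop OUTER mVar (.ite (.ieq (.get PARTNER (var OUTER)) (.const 0))
    (.setI LABEL (var OUTER) (.const 0)) (.setI LABEL (var OUTER) (.const 1)))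

/-- Remembers the current pair unless its score is less than the best score so far. -/
def record : Cmd :=
  .ite (.rlt (.mul (varR TOTAL) (.ofInt (var BESTCARD))) (.mul (varR BEST) (.ofInt (var COUNT))))
    .skip
    (.seq copyLabels (.seq (assign BESTCARD (var COUNT)) (assignR BEST (varR TOTAL))))

/-- The expression for the last entry of the stack. -/
abbrev top : IExp := .get STACK (.sub (var HEIGHT) (.const 1))

/-- Chooses the last vertex on the stack, or the junk value `n` if the stack is empty. -/
def chooseTop : Cmd :=
  .seq (assign CHOSEN nVar) (.ite (.ilt (.const 0) (var HEIGHT)) (assign CHOSEN top) .skip)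

/-- Chooses `v` instead of the chosen vertex if that is an improvement. -/
def consider (v : IExp) : Cmd :=
  .ite (.and (.ieq (.get VERT v) (.const 1)) (.not (.and (.not (.ieq (var CHOSEN) nVar))
      (.not (.rlt (.get PRIO v) (.get PRIO (var CHOSEN)))))))
    (assign CHOSEN v) .skip

/-- Considers all vertices that are on an edge of the input graph. -/
def considerEndpoints : Cmd :=
  forLoop OUTER mVar
    (.seq (consider (.get SRC (var OUTER))) (consider (.get DST (var OUTER))))

/-- Removes the chosen vertex from the stack. -/
def popChosen : Cmd :=
  .ite (.and (.ilt (.const 0) (var HEIGHT)) (.ieq top (var CHOSEN)))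
    (assign HEIGHT (.sub (var HEIGHT) (.const 1))) .skip

/-- Chooses a vertex of least priority. Of the vertices on no edge of the input graph, all of which
have priority zero, only the last one on the stack is considered, so that the time is `O(m)`. -/
def selectVertex : Cmd := .seq chooseTop (.seq considerEndpoints popChosen)

/-- Deletes the edges at the chosen vertex. -/
def deleteEdges : Cmd :=
  forLoop OUTER mVar
    (.ite (isEnd (var OUTER) (var CHOSEN)) (.setI EDGE (var OUTER) (.const 0)) .skip)

/-- Deletes the chosen vertex and its edges. -/
def deleteVertex : Cmd :=
  .seq (.seq (.setI VERT (var CHOSEN) (.const 0)) (.seq (.setI TIME (var CHOSEN) (var COUNT))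
    (assign COUNT (.sub (var COUNT) (.const 1))))) deleteEdges

/-- Deletes the chosen vertex and updates the matching and the priorities. -/
def removeChosen : Cmd := .seq deleteVertex (.seq updateMatching computePriorities)

/-- The body of the main loop. -/
def body : Cmd := .seq (.seq record selectVertex) removeChosen

section IsolatedStack

variable {n m : ℕ} {G : SimpleGraph (Fin n)} {E : EdgeList G m} {U : Finset (Fin n)}
  {k : ℕ} {f : ℕ → ℕ} {u : Fin n}

namespace IsolatedStack

theorem le (h : IsolatedStack E U k f) : k ≤ n := by
  have hsub := h.mapsTo.image_subset.trans (Set.image_subset_range _ _)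
  have := Set.ncard_le_ncard hsub
  rw [h.injOn.ncard_image, Set.ncard_Iio_nat,
    Set.ncard_range_of_injective Fin.val_injective] at this
  simpa using this

theorem exists_top (h : IsolatedStack E U k f) (hk : 0 < k) :
    ∃ v ∈ U, (∀ e, v ∉ E.edge e) ∧ IsTop k f v := by
  obtain ⟨v, hv, heq⟩ := h.mapsTo (Nat.sub_one_lt_of_lt hk)
  exact ⟨v, hv.1, hv.2, hk, heq.symm⟩

theorem pos (h : IsolatedStack E U k f) (hu : u ∈ U) (hiso : ∀ e, u ∉ E.edge e) : 0 < k := by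
  obtain ⟨j, hj, -⟩ := h.surjOn ⟨u, ⟨hu, hiso⟩, rfl⟩
  exact Nat.zero_lt_of_lt hj

theorem pop (h : IsolatedStack E U k f) (hu : IsTop k f u) :
    IsolatedStack E (U.erase u) (k - 1) f := by
  have hIio : Set.Iio k \ {k - 1} = Set.Iio (k - 1) := by
    ext j
    simp only [Set.mem_Iio, Set.mem_sdiff, Set.mem_singleton_iff]
    omega
  have herase : {v | v ∈ U.erase u ∧ ∀ e, v ∉ E.edge e} =
      {v | v ∈ U ∧ ∀ e, v ∉ E.edge e} \ {u} := by
    ext v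
    simp only [Finset.mem_erase, Set.mem_ofPred_eq, Set.mem_sdiff, Set.mem_singleton_iff]
    tauto
  rw [IsolatedStack, herase, Set.image_sdiff Fin.val_injective, Set.image_singleton, ← hu.2, ← hIio]
  exact h.sdiff_singleton (Set.mem_Iio.2 (Nat.sub_one_lt_of_lt hu.1))

theorem erase (h : IsolatedStack E U k f) {e : Fin m} (hu : u ∈ E.edge e) :
    IsolatedStack E (U.erase u) k f := by
  have herase : {v | v ∈ U.erase u ∧ ∀ e, v ∉ E.edge e} = {v | v ∈ U ∧ ∀ e, v ∉ E.edge e} := by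
    ext v
    simp only [Finset.mem_erase, Set.mem_ofPred_eq, and_congr_left_iff, and_iff_right_iff_imp]
    rintro hv - rfl
    exact hv e hu
  rwa [IsolatedStack, herase]

end IsolatedStack

end IsolatedStack

/-- The word `x` is an element of `S` that minimizes `w`, or the junk value `n` if `S` is empty. -/
def IsArgmin {n : ℕ} (w : Fin n → ℝ) (S : Set (Fin n)) (x : ℕ) : Prop :=
  (S = ∅ ∧ x = n) ∨ ∃ u ∈ S, x = u ∧ ∀ v ∈ S, w u ≤ w v

section Body

variable {n m W : ℕ} {G : SimpleGraph (Fin n)} {E : EdgeList G m} {lam : ℝ} {U : Finset (Fin n)}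
  {M : Set (Sym2 (Sym2 (Fin n)))} {s s' : State} {p : Cmd} {u : Fin n}

namespace Maintains

theorem of_frame (h : Maintains E lam U M s) (hF : Frame p s s')
    (hI : ∀ a ∈ [SIZE, SRC, DST, COUNT, VERT, EDGE, PARTNER, START, LENGTH, LIST],
      p.writesI a = false)
    (hR : ∀ a ∈ [LAM, PRIO, TOTAL], p.writesR a = false) : Maintains E lam U M s' := by
  have hsubset : [SIZE, SRC, DST, EDGE, START, LENGTH, LIST] ⊆
      [SIZE, SRC, DST, COUNT, VERT, EDGE, PARTNER, START, LENGTH, LIST] := by decide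
  have hG := h.toStoresGraph.of_frame hF (fun a ha => hI a (hsubset ha)) (hR LAM (by simp))
  simp only [List.forall_mem_cons] at hI hR
  obtain ⟨-, -, -, hcount, hvert, -, hpartner, -⟩ := hI
  obtain ⟨-, hprio, htotal, -⟩ := hR
  refine ⟨hG, ?_, ?_, ?_, ?_, ?_⟩ <;>
    simp only [hF.ints hcount, hF.ints hvert, hF.ints hpartner, hF.reals hprio, hF.reals htotal]
  exacts [h.count, h.vertices, h.matching, h.priority, h.total]

theorem represents (h : Maintains E lam U M s) : Represents E lam U M s where
  count := h.count
  vertices := h.vertices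
  edges := h.edges
  matching e := by
    refine ⟨h.matching.mem_iff e, fun hno => ?_⟩
    by_contra hne
    obtain ⟨f, hf⟩ := h.matching.exists_partner e hne
    exact hno f ((h.matching.mem_iff e f).2 hf)
  wedges := h.restrict_adj_iff
  priorities v _ := h.priority v

theorem count_lt (h : Maintains E lam U M s) (hnW : n < W) : s.ints COUNT 0 < W := by
  rw [h.count]
  exact (card_finset_fin_le U).trans_lt hnW

end Maintains

theorem Remembers.of_frame (h : Remembers E lam U M s) (hF : Frame p s s')
    (hI : ∀ a ∈ [LABEL, BESTCARD], p.writesI a = false) (hR : p.writesR BEST = false) :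
    Remembers E lam U M s' := by
  simp only [List.forall_mem_cons] at hI
  obtain ⟨hlabel, hcard, -⟩ := hI
  constructor <;> simp only [hF.ints hlabel, hF.ints hcard, hF.reals hR]
  exacts [h.card, h.total, h.weak, h.strong]

theorem Recorded.of_frame {s'' : State} (h : Recorded E lam U M s s') (hF : Frame p s' s'')
    (hI : ∀ a ∈ [LABEL, BESTCARD], p.writesI a = false) (hR : p.writesR BEST = false) :
    Recorded E lam U M s s'' := by
  intro U' M' h'
  have := h U' M' h'
  split_ifs at this ⊢ <;> exact this.of_frame hF hI hR

theorem runs_copyLabels (hmW : m < W) (hW : 1 < W) (hm : s.ints SIZE 1 = m)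
    (hM : StoresMatching E M (s.ints PARTNER)) :
    Runs W copyLabels s (40 * (m + 1)) fun s' => ∀ e : Fin m,
      (E.edge e ∈ weakEdges M → s'.ints LABEL e = 1) ∧
      (E.edge e ∉ weakEdges M → s'.ints LABEL e = 0) := by
  have weak (e : Fin m) : E.edge e ∈ weakEdges M ↔ s.ints PARTNER e ≠ 0 := hM.covered_iff e
  refine (Runs.forLoop_wp (fun i s' => ∀ j < i, s'.ints LABEL j =
    if s.ints PARTNER j = 0 then 0 else 1) (C := 40) (by decide) hmW rfl
    (fun s' hF => by simpa [IExp.eval, hF.ints (a := SIZE) rfl]) (by simp) ?_).mono le_rfl ?_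
  · intro i s' hi hF hI ha
    simp only [Cmd.wp, IExp.eval, BExp.Holds, ha, hF.ints (a := PARTNER) rfl, State.setI_ints,
      Nat.reduceEqDiff, reduceIte, Nat.lt_succ_iff_lt_or_eq]
    refine ⟨fun h => ⟨Nat.zero_lt_of_lt hW, ?_⟩, fun h => ⟨hW, ?_⟩⟩ <;>
    · rintro j (hj | rfl)
      · rw [Function.update_of_ne hj.ne, hI j hj]
      · simp [h]
  · intro s' h _ e
    simp only [weak, h e e.is_lt]
    exact ⟨fun h => if_neg h, fun h => if_pos (not_not.1 h)⟩

theorem runs_record (hmW : m < W) (hnW : n < W) (hW : 1 < W) (h : Maintains E lam U M s) :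
    Runs W record s (100 * (m + 1)) (Recorded E lam U M s) := by
  have hcountW := h.count_lt hnW
  refine (Runs.ite (T := 40 * (m + 1) + 20) (fun hb => ?_) fun hb => ?_).mono_time ?_
  · simp only [BExp.Holds, RExp.eval, IExp.eval, h.total, h.count] at hb
    refine (Runs.of_wp (Q := Recorded E lam U M s) fun U' M' h' => ?_).mono_time ?_
    · rwa [if_pos (by rwa [← h'.card, ← h'.total])]
    · simp only [Cmd.loopFreeCost]; omega
  · simp only [BExp.Holds, RExp.eval, IExp.eval, h.total, h.count] at hb
    refine (Runs.seq (runs_copyLabels hmW hW h.m_eq h.matching) fun s₁ hs₁ hF =>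
      .of_wp (Q := Recorded E lam U M s) ?_).mono_time ?_
    · refine ⟨by simpa [IExp.eval, hF.ints (a := COUNT) rfl], fun U' M' h' => ?_⟩
      rw [if_neg (by rwa [← h'.card, ← h'.total])]
      constructor
      · simp [IExp.eval, hF.ints (a := COUNT) rfl, h.count]
      · simp [IExp.eval, RExp.eval, hF.reals (a := TOTAL) rfl, h.total]
      · simpa using fun e => (hs₁ e).1
      · simpa using fun e => (hs₁ e).2
    · simp only [Cmd.loopFreeCost, IExp.cost, RExp.cost]; omega
  · simp only [BExp.cost, IExp.cost, RExp.cost]; omega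

namespace IsArgmin

variable {w : Fin n → ℝ} {S : Set (Fin n)} {x : ℕ} {v : Fin n}

theorem insert_of_lt (h : IsArgmin w S x) (hv : ∀ u : Fin n, x = u → w v < w u) :
    IsArgmin w (insert v S) v := by
  refine .inr ⟨v, Set.mem_insert v S, rfl, ?_⟩
  rintro v' (rfl | hv')
  · exact le_rfl
  · obtain ⟨rfl, -⟩ | ⟨u, -, hx, hmin⟩ := h
    · exact absurd hv' (Set.notMem_empty v')
    · exact (hv u hx).le.trans (hmin v' hv')

theorem insert_of_le (h : IsArgmin w S x) (hx : x = u) (hv : w u ≤ w v) :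
    IsArgmin w (insert v S) x := by
  obtain ⟨-, hxn⟩ | ⟨u', hu', hx', hmin⟩ := h
  · exact absurd (hx.symm.trans hxn) u.is_lt.ne
  · obtain rfl : u = u' := Fin.ext (hx.symm.trans hx')
    exact .inr ⟨u, Set.mem_insert_of_mem v hu', hx, Set.forall_mem_insert.2 ⟨hv, hmin⟩⟩

end IsArgmin

/-- The priorities of the vertices for the labeling given by `M`. -/
noncomputable abbrev priorities {n : ℕ} (G : SimpleGraph (Fin n)) (lam : ℝ) (U : Finset (Fin n))
    (M : Set (Sym2 (Sym2 (Fin n)))) : Fin n → ℝ := weightedDegree G lam U (weakEdges M)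

theorem runs_consider (hnW : n < W) (h : Maintains E lam U M s) {T : Set (Fin n)}
    (hT : IsArgmin (priorities G lam U M) (U ∩ T) (s.ints CHOSEN 0)) {k : IExp} {v : Fin n}
    (hk : k.eval s = v) :
    Runs W (consider k) s (consider k).loopFreeCost fun s' =>
      IsArgmin (priorities G lam U M) (U ∩ insert v T) (s'.ints CHOSEN 0) := by
  refine .of_wp ?_
  simp only [consider, Cmd.wp, IExp.eval, BExp.Holds, RExp.eval, hk, h.n_eq, h.vertices,
    h.priority, ite_eq_left_iff, zero_ne_one, imp_false, not_not]
  refine ⟨fun ⟨hvU, hlt⟩ => ⟨v.is_lt.trans hnW, ?_⟩, fun hb => ?_⟩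
  · rw [Set.inter_insert_of_mem (Finset.mem_coe.2 hvU)]
    simp only [State.setI_ints, reduceIte, Function.update_self]
    refine hT.insert_of_lt fun u hu => ?_
    by_contra hle
    exact hlt ⟨hu ▸ u.is_lt.ne, by rwa [hu, h.priority]⟩
  · by_cases hvU : v ∈ U
    · rw [Set.inter_insert_of_mem (Finset.mem_coe.2 hvU)]
      obtain ⟨hne, hle⟩ := not_not.1 fun hlt => hb ⟨hvU, hlt⟩
      obtain ⟨-, hx⟩ | ⟨u, -, hu, -⟩ := id hT
      · exact absurd hx hne
      · rw [hu, h.priority, not_lt] at hle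
        exact hT.insert_of_le hu hle
    · rwa [Set.inter_insert_of_notMem (mt Finset.mem_coe.1 hvU)]

theorem runs_chooseTop (hnW : n < W) (hn : s.ints SIZE 0 = n)
    (hstack : IsolatedStack E U (s.ints HEIGHT 0) (s.ints STACK)) (w : Fin n → ℝ) :
    Runs W chooseTop s 30 fun s' =>
      IsArgmin w (U ∩ {v | IsTop (s.ints HEIGHT 0) (s.ints STACK) v}) (s'.ints CHOSEN 0) := by
  refine (Runs.of_wp ?_).mono_time (by decide)
  simp only [chooseTop, Cmd.wp, IExp.eval, BExp.Holds, hn, State.setI_ints, Nat.reduceEqDiff,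
    reduceIte, Function.update_self]
  refine ⟨hnW, fun hpos => ?_, fun hpos => .inl ⟨?_, rfl⟩⟩
  · obtain ⟨v, hvU, -, hv⟩ := hstack.exists_top hpos
    refine ⟨hv.2 ▸ v.is_lt.trans hnW, .inr ⟨v, ⟨hvU, hv⟩, hv.2, ?_⟩⟩
    rintro v' ⟨-, hv'⟩
    rw [Fin.ext (hv.2.symm.trans hv'.2)]
  · simp [IsTop, hpos]

theorem runs_considerEndpoints (hmW : m < W) (hnW : n < W) (h : Maintains E lam U M s)
    {T : Set (Fin n)} (hT : IsArgmin (priorities G lam U M) (U ∩ T) (s.ints CHOSEN 0)) :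
    Runs W considerEndpoints s (100 * (m + 1)) fun s' =>
      IsArgmin (priorities G lam U M) (U ∩ {v | v ∈ T ∨ ∃ e, v ∈ E.edge e})
        (s'.ints CHOSEN 0) := by
  refine (Runs.forLoop_const (fun i s' => IsArgmin (priorities G lam U M)
      (U ∩ {v | v ∈ T ∨ ∃ e : Fin m, e.val < i ∧ v ∈ E.edge e}) (s'.ints CHOSEN 0))
    (T := 80) (C := 100) (by decide) hmW
    rfl (fun s' hF => by exact (h.toHasInput.of_frame hF (by decide) rfl).m_eq)
    (by simpa using hT) ?_).mono le_rfl fun s' hs' _ => by simpa using hs'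
  intro i s' hi hF hI ha
  lift i to Fin m using hi with e
  have h' := h.of_frame hF (by decide) (by decide)
  refine (Runs.seq (runs_consider hnW h' hI (v := E.src e) ?_) fun s₁ hs₁ hF₁ =>
    runs_consider hnW (h'.of_frame hF₁ (by decide) (by decide)) hs₁ (v := E.dst e) ?_).mono
      (by decide) fun s₂ hs₂ _ => ?_
  · simp [IExp.eval, ha, h'.src]
  · simp [IExp.eval, ha, hF₁.ints (a := OUTER) rfl, hF₁.ints (a := DST) rfl, h'.dst]
  · have hset : {v | v ∈ T ∨ ∃ f : Fin m, f.val < e.val + 1 ∧ v ∈ E.edge f} = insert (E.dst e)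
        (insert (E.src e) {v | v ∈ T ∨ ∃ f : Fin m, f.val < e.val ∧ v ∈ E.edge f}) := by
      ext v
      simp only [Set.mem_ofPred_eq, Set.mem_insert_iff, Nat.lt_succ_iff_lt_or_eq, Fin.val_inj,
        or_and_right, exists_or, exists_eq_left, E.mem_edge]
      grind
    simpa only [hset, State.setI_ints, Nat.reduceEqDiff, reduceIte] using hs₂

theorem IsolatedStack.exists_argmin {k x : ℕ} {f : ℕ → ℕ} (h : IsolatedStack E U k f)
    (hne : U.Nonempty) {w : Fin n → ℝ} (hw : ∀ v, (∀ e, v ∉ E.edge e) → w v = 0)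
    (hx : IsArgmin w (U ∩ {v | IsTop k f v ∨ ∃ e, v ∈ E.edge e}) x) :
    ∃ u ∈ U, (IsTop k f u ∨ ∃ e, u ∈ E.edge e) ∧ x = u ∧ ∀ v ∈ U, w u ≤ w v := by
  have dominated : ∀ v ∈ U, ∃ v' ∈ (U : Set (Fin n)) ∩ {v | IsTop k f v ∨ ∃ e, v ∈ E.edge e},
      w v' = w v := by
    intro v hv
    by_cases hiso : ∀ e, v ∉ E.edge e
    · obtain ⟨t, htU, htiso, ht⟩ := h.exists_top (h.pos hv hiso)
      exact ⟨t, ⟨htU, .inl ht⟩, (hw t htiso).trans (hw v hiso).symm⟩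
    · exact ⟨v, ⟨hv, .inr (by simpa using hiso)⟩, rfl⟩
  obtain ⟨hempty, -⟩ | ⟨u, ⟨huU, hu⟩, hxu, hmin⟩ := hx
  · obtain ⟨v, hv⟩ := hne
    obtain ⟨v', hv', -⟩ := dominated v hv
    simp [hempty] at hv'
  · refine ⟨u, huU, hu, hxu, fun v hv => ?_⟩
    obtain ⟨v', hv', heq⟩ := dominated v hv
    exact heq ▸ hmin v' hv'

theorem runs_popChosen (hnW : n < W) (hu : s.ints CHOSEN 0 = u)
    (h : IsolatedStack E U (s.ints HEIGHT 0) (s.ints STACK))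
    (hcases : IsTop (s.ints HEIGHT 0) (s.ints STACK) u ∨ ∃ e, u ∈ E.edge e) :
    Runs W popChosen s 30 fun s' => s'.ints CHOSEN 0 = u ∧
      IsolatedStack E (U.erase u) (s'.ints HEIGHT 0) (s'.ints STACK) := by
  refine (Runs.of_wp ?_).mono_time (by decide)
  simp only [popChosen, Cmd.wp, IExp.eval, BExp.Holds, hu, State.setI_ints, Nat.reduceEqDiff,
    reduceIte, Function.update_self]
  have hheight := h.le
  refine ⟨fun htop => ⟨by omega, trivial, h.pop htop⟩, fun htop => ⟨trivial, ?_⟩⟩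
  obtain ⟨e, he⟩ := hcases.resolve_left htop
  exact h.erase he

theorem runs_selectVertex (hmW : m < W) (hnW : n < W) (h : Maintains E lam U M s)
    (hstack : IsolatedStack E U (s.ints HEIGHT 0) (s.ints STACK)) (hne : U.Nonempty) :
    Runs W selectVertex s (160 * (m + 1)) fun s' => ∃ u ∈ U,
      (∀ v ∈ U, priorities G lam U M u ≤ priorities G lam U M v) ∧ s'.ints CHOSEN 0 = u ∧
      IsolatedStack E (U.erase u) (s'.ints HEIGHT 0) (s'.ints STACK) := by
  refine (Runs.seq (runs_chooseTop hnW h.n_eq hstack (priorities G lam U M)) fun s₁ hs₁ hF₁ =>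
    Runs.seq (runs_considerEndpoints hmW hnW (h.of_frame hF₁ (by decide) (by decide)) hs₁)
    (T' := 30) fun s₂ hs₂ hF₂ => ?_).mono_time (by omega)
  obtain ⟨u, huU, hu, hchosen, hmin⟩ := hstack.exists_argmin hne
    (fun v hv => E.weightedDegree_eq_zero hv lam U _) hs₂
  rw [← hF₁.ints (a := HEIGHT) rfl, ← hF₁.ints (a := STACK) rfl, ← hF₂.ints (a := HEIGHT) rfl,
    ← hF₂.ints (a := STACK) rfl] at hstack hu
  exact (runs_popChosen hnW hchosen hstack hu).mono le_rfl fun s₃ hs₃ _ => ⟨u, huU, hmin, hs₃⟩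

theorem runs_deleteEdges (hmW : m < W) (hG : StoresGraph E lam U s) (hu : s.ints CHOSEN 0 = u) :
    Runs W deleteEdges s (40 * (m + 1)) fun s' => StoresGraph E lam (U.erase u) s' := by
  have hin' {s'} (hF : Frame deleteEdges s s') : HasInput E lam s' :=
    hG.toHasInput.of_frame hF (by decide) rfl
  refine (Runs.forLoop_wp (fun i s' => ∀ e : Fin m, s'.ints EDGE e =
    if e.val < i ∧ u ∈ E.edge e then 0 else s.ints EDGE e) (C := 40) (by decide) hmW rfl
    (fun s' hF => (hin' hF).m_eq) (by simp) ?_).mono le_rfl ?_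
  · intro i s' hi hF hI ha
    lift i to Fin m using hi with e
    have hend := (hin' hF).isEnd_holds (k := var OUTER) (l := var CHOSEN) (u := u) ha
      (by simpa [IExp.eval, hF.ints (a := CHOSEN) rfl])
    simp only [Cmd.wp, hend, IExp.eval, ha, State.setI_ints, Nat.reduceEqDiff, reduceIte]
    refine ⟨fun hue => ⟨by omega, fun f => ?_⟩, fun hue f => ?_⟩ <;>
    · obtain rfl | hne := eq_or_ne f e
      · simp [hue, hI]
      · simp [hI, Fin.val_ne_of_ne hne, hne.le_iff_lt]
  · intro s' hs' hF
    exact {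
      toHasInput := hin' hF
      edges := fun e => by
        rw [hs', hG.edges]
        simp only [e.is_lt, true_and, E.mem_edge, Finset.mem_erase]
        grind
      length_le := by simpa only [hF.ints (a := LENGTH) rfl] using hG.length_le
      entry_lt := by
        simpa only [hF.ints (a := LENGTH) rfl, hF.ints (a := LIST) rfl,
          hF.ints (a := START) rfl] using hG.entry_lt
      adj_iff := by
        simpa only [hF.ints (a := LENGTH) rfl, hF.ints (a := LIST) rfl,
          hF.ints (a := START) rfl] using hG.adj_iff }

theorem runs_deleteVertex (hmW : m < W) (hnW : n < W) (h : Maintains E lam U M s) (huU : u ∈ U)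
    (hu : s.ints CHOSEN 0 = u) :
    Runs W deleteVertex s (80 * (m + 1)) fun s' => StoresGraph E lam (U.erase u) s' ∧
      s'.ints COUNT 0 = (U.erase u).card ∧
      (∀ v : Fin n, s'.ints VERT v = if v ∈ U.erase u then 1 else 0) ∧
      s'.ints TIME = Function.update (s.ints TIME) u U.card := by
  have hcountW := h.count ▸ h.count_lt hnW
  refine (Runs.seq (.of_wp (Q := fun s' => s'.ints COUNT 0 = (U.erase u).card ∧
      (∀ v : Fin n, s'.ints VERT v = if v ∈ U.erase u then 1 else 0) ∧
      s'.ints TIME = Function.update (s.ints TIME) u U.card) ?_) fun s₁ hs₁ hF₁ =>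
    (runs_deleteEdges hmW (h.toStoresGraph.of_frame hF₁ (by decide) rfl)
      (by rw [hF₁.ints rfl, hu])).mono le_rfl fun s₂ hs₂ hF₂ => ?_).mono_time ?_
  · simp only [Cmd.wp, IExp.eval, State.setI_ints, Nat.reduceEqDiff, reduceIte,
      Function.update_self, hu, h.count, Finset.card_erase_of_mem huU]
    refine ⟨by omega, hcountW, by omega, trivial, fun v => ?_, trivial⟩
    simp [Function.update_apply, h.vertices, Fin.val_inj, ite_and, ite_not]
  · rw [hF₂.ints (a := COUNT) rfl, hF₂.ints (a := VERT) rfl, hF₂.ints (a := TIME) rfl]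
    exact ⟨hs₂, hs₁⟩
  · simp only [Cmd.loopFreeCost, IExp.cost]; omega

theorem runs_removeChosen (hmW : m < W) (hnW : n < W) (h : Maintains E lam U M s)
    (hMU : M ⊆ (wedgeGraph (restrict G U)).edgeSet) (huU : u ∈ U) (hu : s.ints CHOSEN 0 = u) :
    Runs W removeChosen s
      (300 * (m + 1) + Finset.card {e | u ∈ E.edge e} * (100 * (n + 1))) fun s' =>
      s'.ints TIME = Function.update (s.ints TIME) u U.card ∧
      ∃ M', DynamicVertexCover (wedgeGraph (restrict G (U.erase u)))
        ((restrict G U).incidenceSet u) M M' ∧ Maintains E lam (U.erase u) M' s' := by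
  refine (Runs.seq (runs_deleteVertex hmW hnW h huU hu) fun s₁ ⟨hG, hcount, hvert, htime⟩ hF₁ =>
    .seq (runs_updateMatching hmW hnW hG (by rw [hF₁.ints rfl, hu])
      (by rw [hF₁.ints rfl]; exact h.matching) hMU) (T' := 140 * (m + 1))
      fun s₂ ⟨M', hdyn, hM'⟩ hF₂ => ?_).mono_time (by omega)
  have hG₂ := hG.of_frame hF₂ (by decide) rfl
  refine (runs_computePriorities hmW hG₂ hM' fun v hv => ?_).mono le_rfl
    fun s₃ ⟨hprio, htotal⟩ hF₃ => ⟨?_, M', hdyn, ?_⟩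
  · rw [hF₂.reals rfl, hF₁.reals rfl, h.priority, E.weightedDegree_eq_zero hv]
  · rw [hF₃.ints rfl, hF₂.ints rfl, htime]
  · refine ⟨hG₂.of_frame hF₃ (by decide) rfl, ?_, ?_, ?_, hprio, htotal⟩
    · rw [hF₃.ints rfl, hF₂.ints rfl, hcount]
    · rw [hF₃.ints rfl, hF₂.ints rfl]; exact hvert
    · rw [hF₃.ints rfl]; exact hM'

theorem runs_body (hmW : m < W) (hnW : n < W) (hW : 1 < W) (h : Maintains E lam U M s)
    (hstack : IsolatedStack E U (s.ints HEIGHT 0) (s.ints STACK))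
    (hMU : M ⊆ (wedgeGraph (restrict G U)).edgeSet) (hne : U.Nonempty) :
    ∃ u ∈ U, (∀ v ∈ U, priorities G lam U M u ≤ priorities G lam U M v) ∧
      Runs W body s (560 * (m + 1) + Finset.card {e | u ∈ E.edge e} * (100 * (n + 1))) fun s' =>
        Recorded E lam U M s s' ∧ s'.ints TIME = Function.update (s.ints TIME) u U.card ∧
        IsolatedStack E (U.erase u) (s'.ints HEIGHT 0) (s'.ints STACK) ∧
        ∃ M', DynamicVertexCover (wedgeGraph (restrict G (U.erase u)))
          ((restrict G U).incidenceSet u) M M' ∧ Maintains E lam (U.erase u) M' s' := by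
  obtain ⟨s₁, t₁, he₁, ht₁, hrec⟩ := runs_record hmW hnW hW h
  have h₁ := h.of_frame he₁.frame (by decide) (by decide)
  rw [← he₁.frame.ints (a := HEIGHT) rfl, ← he₁.frame.ints (a := STACK) rfl] at hstack
  obtain ⟨s₂, t₂, he₂, ht₂, u, huU, hmin, hu, hstack₂⟩ :=
    runs_selectVertex hmW hnW h₁ hstack hne
  have h₂ := h₁.of_frame he₂.frame (by decide) (by decide)
  obtain ⟨s₃, t₃, he₃, ht₃, htime, M', hdyn, h₃⟩ := runs_removeChosen hmW hnW h₂ hMU huU hu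
  refine ⟨u, huU, hmin, s₃, _, .seq _ _ _ _ _ _ _ (.seq _ _ _ _ _ _ _ he₁ he₂) he₃, by omega,
    ?_, ?_, ?_, M', hdyn, h₃⟩
  · exact (hrec.of_frame he₂.frame (by decide) rfl).of_frame he₃.frame (by decide) rfl
  · rw [htime, he₂.frame.ints rfl, he₁.frame.ints rfl]
  · rwa [he₃.frame.ints rfl, he₃.frame.ints rfl]

end Body

end STC

/-! ## The program: initialization and output -/

namespace STC

open RAM

theorem cell_injective {n x y x' y' : ℕ} (hy : y < n) (hy' : y' < n)
    (h : x * n + y = x' * n + y') : x = x' ∧ y = y' := by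
  have hn : 0 < n := Nat.zero_lt_of_lt hy
  have hdiv := congrArg (· / n) h
  have hmod := congrArg (· % n) h
  simp only [Nat.mul_comm _ n, Nat.mul_add_div hn, Nat.div_eq_of_lt hy, Nat.div_eq_of_lt hy',
    add_zero, Nat.mul_add_mod, Nat.mod_eq_of_lt hy, Nat.mod_eq_of_lt hy'] at hdiv hmod
  exact ⟨hdiv, hmod⟩

section Tables

variable {n m : ℕ} {G : SimpleGraph (Fin n)} (E : EdgeList G m)

/-- The array `A` holds the adjacency matrix of the graph with edge set `S`, row by row. The entry
of an edge is its index plus one. -/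
structure StoresMatrix (S : Set (Sym2 (Fin n))) (A : ℕ → ℕ) : Prop where
  eq_zero : ∀ x y : Fin n, s(x, y) ∉ S → A (x * n + y) = 0
  eq_succ : ∀ (e : Fin m) (x y : Fin n), E.edge e ∈ S → E.edge e = s(x, y) → A (x * n + y) = e + 1

/-- The edge `f` forms a wedge with the edge `e`, and `v` is its endpoint that is not on `e`. -/
def WedgeAt (e : Fin m) (v : Fin n) (f : Fin m) : Prop :=
  (IsWedge G (E.dst e) (E.src e) v ∧ E.edge f = s(E.src e, v)) ∨
  (IsWedge G (E.src e) (E.dst e) v ∧ E.edge f = s(E.dst e, v))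

/-- The adjacency list of the edge `e` starts at the cell `e * n` of the array `list`, has length
`len e`, and holds the edges that form a wedge with `e` through one of the first `k e` vertices. -/
structure StoresLists (k : Fin m → ℕ) (len list : ℕ → ℕ) : Prop where
  length_le : ∀ e : Fin m, len e ≤ k e
  image_eq : ∀ e : Fin m, (fun j => list (e * n + j)) '' Set.Iio (len e) =
    Fin.val '' {f | ∃ v : Fin n, v.val < k e ∧ WedgeAt E e v f}

variable {E} {S : Set (Sym2 (Fin n))} {A len list : ℕ → ℕ} {k : Fin m → ℕ}

namespace StoresMatrix

protected theorem insert (h : StoresMatrix E S A) (e : Fin m) :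
    StoresMatrix E (insert (E.edge e) S) (Function.update
      (Function.update A (E.src e * n + E.dst e) (e + 1)) (E.dst e * n + E.src e) (e + 1)) := by
  have cell_eq_iff (x y x' y' : Fin n) :
      (x * n + y : ℕ) = x' * n + y' ↔ x = x' ∧ y = y' :=
    ⟨fun hc => (cell_injective y.is_lt y'.is_lt hc).imp Fin.ext Fin.ext, by rintro ⟨rfl, rfl⟩; rfl⟩
  have update_eq (x y : Fin n) : Function.update
      (Function.update A (E.src e * n + E.dst e) (e + 1)) (E.dst e * n + E.src e) (e + 1)
        (x * n + y) = if s(x, y) = E.edge e then (e : ℕ) + 1 else A (x * n + y) := by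
    simp only [Function.update_apply, cell_eq_iff, EdgeList.edge, Sym2.eq_iff]
    grind
  constructor
  · intro x y hxy
    rw [Set.mem_insert_iff, not_or] at hxy
    rw [update_eq, if_neg hxy.1, h.eq_zero x y hxy.2]
  · intro f x y hf hxy
    simp only [update_eq, ← hxy, E.edge_injective.eq_iff]
    split_ifs with hfe
    · rw [hfe]
    · exact h.eq_succ f x y (hf.resolve_left (E.edge_injective.ne hfe)) hxy

theorem exists_eq_succ (h : StoresMatrix E G.edgeSet A) {x y : Fin n} (hxy : G.Adj x y) :
    ∃ e : Fin m, A (x * n + y) = e + 1 ∧ E.edge e = s(x, y) := by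
  obtain ⟨e, he⟩ := E.exists_edge_eq (G.mem_edgeSet.2 hxy)
  exact ⟨e, h.eq_succ e x y (E.edge_mem e) he, he⟩

theorem eq_zero_iff (h : StoresMatrix E G.edgeSet A) (x y : Fin n) :
    A (x * n + y) = 0 ↔ ¬ G.Adj x y := by
  refine ⟨fun h0 hxy => ?_, fun hxy => h.eq_zero x y hxy⟩
  obtain ⟨e, he, -⟩ := h.exists_eq_succ hxy
  omega

end StoresMatrix

theorem wedgeAt_iff_of_isWedge_src {e f : Fin m} {v : Fin n}
    (h : IsWedge G (E.dst e) (E.src e) v) : WedgeAt E e v f ↔ E.edge f = s(E.src e, v) :=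
  ⟨fun hf => hf.elim And.right fun hf => absurd h.2.1 hf.1.2.2.2, fun hf => .inl ⟨h, hf⟩⟩

theorem wedgeAt_iff_of_isWedge_dst {e f : Fin m} {v : Fin n}
    (h : IsWedge G (E.src e) (E.dst e) v) : WedgeAt E e v f ↔ E.edge f = s(E.dst e, v) :=
  ⟨fun hf => hf.elim (fun hf => absurd h.2.1 hf.1.2.2.2) And.right, fun hf => .inr ⟨h, hf⟩⟩

theorem wedgeGraph_adj_iff_wedgeAt (e f : Fin m) :
    (wedgeGraph G).Adj (E.edge e) (E.edge f) ↔ ∃ v, WedgeAt E e v f := by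
  constructor
  · rintro ⟨x, y, z, hw, he, hf⟩
    refine ⟨z, ?_⟩
    rcases Sym2.eq_iff.1 he with ⟨rfl, rfl⟩ | ⟨rfl, rfl⟩
    exacts [.inr ⟨hw, hf⟩, .inl ⟨hw, hf⟩]
  · rintro ⟨v, ⟨hw, hf⟩ | ⟨hw, hf⟩⟩
    exacts [⟨_, _, v, hw, Sym2.eq_swap, hf⟩, ⟨_, _, v, hw, rfl, hf⟩]

namespace StoresLists

theorem empty (hlen : ∀ e : Fin m, len e = 0) : StoresLists E (fun _ => 0) len list :=
  ⟨fun e => (hlen e).le, fun e => by simp [hlen]⟩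

theorem succ {e : Fin m} {v : Fin n} {len' list' : ℕ → ℕ} (h : StoresLists E k len list)
    (hv : k e = v) (hlen : len' e ≤ v + 1) (hne : ∀ f : Fin m, f ≠ e → len' f = len f ∧
      ∀ j < len f, list' (f * n + j) = list (f * n + j))
    (himage : (fun j => list' (e * n + j)) '' Set.Iio (len' e) =
      (fun j => list (e * n + j)) '' Set.Iio (len e) ∪ Fin.val '' {f | WedgeAt E e v f}) :
    StoresLists E (Function.update k e (v + 1)) len' list' := by
  constructor <;> intro f <;> rcases eq_or_ne f e with rfl | hfe
  · simpa using hlen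
  · rw [Function.update_of_ne hfe, (hne f hfe).1]
    exact h.length_le f
  · rw [himage, h.image_eq, ← Set.image_union, hv, Function.update_self]
    congr 1
    ext g
    simp only [Set.mem_union, Set.mem_ofPred_eq, Nat.lt_succ_iff_lt_or_eq, Fin.val_inj,
      or_and_right, exists_or, exists_eq_left]
  · rw [Function.update_of_ne hfe, ← h.image_eq, (hne f hfe).1]
    exact Set.image_congr (hne f hfe).2

theorem skip {e : Fin m} {v : Fin n} (h : StoresLists E k len list) (hv : k e = v)
    (hf : ∀ f, ¬ WedgeAt E e v f) : StoresLists E (Function.update k e (v + 1)) len list :=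
  h.succ hv ((h.length_le e).trans (by omega)) (fun _ _ => ⟨rfl, fun _ _ => rfl⟩) (by simp [hf])

theorem append {e : Fin m} {v : Fin n} (h : StoresLists E k len list) (hk : ∀ e, k e ≤ n)
    (hv : k e = v) {f : Fin m} (hf : ∀ g, WedgeAt E e v g ↔ g = f) :
    StoresLists E (Function.update k e (v + 1)) (Function.update len e (len e + 1))
      (Function.update list (e * n + len e) f) := by
  have hlen : len e ≤ v := hv ▸ h.length_le e
  have hIio : Set.Iio (len e + 1) = insert (len e) (Set.Iio (len e)) := by
    ext j
    simp only [Set.mem_Iio, Set.mem_insert_iff]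
    omega
  refine h.succ hv (by simpa using hlen) (fun g hge => ⟨?_, fun j hj => ?_⟩) ?_
  · rw [Function.update_of_ne (Fin.val_ne_of_ne hge)]
  · refine Function.update_of_ne (fun hc => hge (Fin.ext ?_)) _ _
    exact (cell_injective (hj.trans_le ((h.length_le g).trans (hk g)))
      (hlen.trans_lt v.is_lt) hc).1
  · have hold : ∀ j ∈ Set.Iio (len e), Function.update list (e * n + len e) f (e * n + j) =
        list (e * n + j) := fun j hj =>
      Function.update_of_ne (by have := Set.mem_Iio.1 hj; omega) _ _
    simp only [hf, Set.ofPred_eq_eq_singleton, Set.image_singleton, Function.update_self, hIio,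
      Set.image_insert_eq]
    rw [Set.image_congr hold, Set.union_singleton]

end StoresLists

end Tables

section IsolatedStack

variable {n m : ℕ} {G : SimpleGraph (Fin n)} {E : EdgeList G m} {U : Finset (Fin n)}
  {k : ℕ} {f : ℕ → ℕ} {v : Fin n}

namespace IsolatedStack

theorem push (h : IsolatedStack E U k f) (hv : v ∉ U) (hiso : ∀ e, v ∉ E.edge e) :
    IsolatedStack E (insert v U) (k + 1) (Function.update f k v) := by
  have hIio : Set.Iio (k + 1) = insert k (Set.Iio k) := by
    ext j
    simp only [Set.mem_Iio, Set.mem_insert_iff]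
    omega
  have hinsert : {w | w ∈ insert v U ∧ ∀ e, w ∉ E.edge e} =
      insert v {w | w ∈ U ∧ ∀ e, w ∉ E.edge e} := by
    ext w
    simp only [Finset.mem_insert, Set.mem_ofPred_eq, Set.mem_insert_iff]
    grind
  have hold : Set.EqOn f (Function.update f k v) (Set.Iio k) := fun j hj =>
    (Function.update_of_ne (Set.mem_Iio.1 hj).ne _ _).symm
  have hnew := (h.congr hold).insert (a := k) (by simp [Fin.val_inj, hv])
  simpa only [IsolatedStack, hIio, hinsert, Set.image_insert_eq, Function.update_self] using hnew

theorem insert_of_mem (h : IsolatedStack E U k f) {e : Fin m} (hv : v ∈ E.edge e) :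
    IsolatedStack E (insert v U) k f := by
  have hinsert : {w | w ∈ insert v U ∧ ∀ e, w ∉ E.edge e} = {w | w ∈ U ∧ ∀ e, w ∉ E.edge e} := by
    ext w
    simp only [Finset.mem_insert, Set.mem_ofPred_eq]
    grind
  rwa [IsolatedStack, hinsert]

end IsolatedStack

end IsolatedStack

/-- The expression for the entry `(x, y)` of the adjacency matrix. -/
abbrev matrixCell (x y : IExp) : IExp := .add (.mul x nVar) y

/-- Enters the edge `e` into the adjacency matrix. -/
def enterEdge (e : IExp) : Cmd :=
  .seq (.setI MATRIX (matrixCell (.get SRC e) (.get DST e)) (.add e (.const 1)))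
    (.setI MATRIX (matrixCell (.get DST e) (.get SRC e)) (.add e (.const 1)))

/-- Marks the endpoints of the edge `e`. -/
def touchEnds (e : IExp) : Cmd :=
  .seq (.setI TOUCHED (.get SRC e) (.const 1)) (.setI TOUCHED (.get DST e) (.const 1))

/-- Enters all edges, marks them and their endpoints, and lets the adjacency list of the edge `e`
start at the cell `e * n`. -/
def markEdges : Cmd :=
  forLoop OUTER mVar (.seq (enterEdge (var OUTER)) (.seq (touchEnds (var OUTER))
    (.seq (.setI EDGE (var OUTER) (.const 1)) (.setI START (var OUTER) (.mul (var OUTER) nVar)))))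

/-- Marks all vertices and puts those on no edge on the stack. -/
def markVertices : Cmd :=
  forLoop OUTER nVar (.seq (.setI VERT (var OUTER) (.const 1))
    (.ite (.ieq (.get TOUCHED (var OUTER)) (.const 0))
      (.seq (.setI STACK (var HEIGHT) (var OUTER)) (assign HEIGHT (.add (var HEIGHT) (.const 1))))
      .skip))

/-- The expression for the entry of the adjacency matrix for `x` and the vertex of the loop. -/
abbrev adjacency (x : IExp) : IExp := .get MATRIX (matrixCell x (var INNER))

/-- Tests whether the edges from `x` to `y` and to the vertex of the loop form a wedge. -/
abbrev formsWedge (x y : IExp) : BExp :=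
  .and (.not (.ieq (adjacency x) (.const 0)))
    (.and (.ieq (adjacency y) (.const 0)) (.not (.ieq y (var INNER))))

/-- Appends the edge from `x` to the vertex of the loop to the list of the edge `e`. -/
def append (e x : IExp) : Cmd :=
  .seq (.setI LIST (.add (.get START e) (.get LENGTH e)) (.sub (adjacency x) (.const 1)))
    (.setI LENGTH e (.add (.get LENGTH e) (.const 1)))

/-- Computes the adjacency list of the edge `e` in the wedge graph. -/
def buildList (e : IExp) : Cmd :=
  forLoop INNER nVar
    (.ite (formsWedge (.get SRC e) (.get DST e)) (append e (.get SRC e))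
      (.ite (formsWedge (.get DST e) (.get SRC e)) (append e (.get DST e)) .skip))

/-- Computes the adjacency lists of the wedge graph. -/
def buildLists : Cmd := forLoop OUTER mVar (buildList (var OUTER))

/-- Stores the graph, its wedge graph and the vertices on no edge. -/
def loadGraph : Cmd := .seq markEdges (.seq markVertices buildLists)

/-- The initialization. -/
def init : Cmd :=
  .seq loadGraph (.seq initMatching (.seq (assign COUNT nVar) computePriorities))

/-- Computes the indicator of the best vertex set from the times of deletion. -/
def fin : Cmd :=
  forLoop OUTER nVar (.ite (.ilt (var BESTCARD) (.get TIME (var OUTER)))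
    (.setI OUT (var OUTER) (.const 0)) (.setI OUT (var OUTER) (.const 1)))

section Initialization

variable {n m W : ℕ} {G : SimpleGraph (Fin n)} {E : EdgeList G m} {lam : ℝ} {s : State}

theorem runs_markEdges (hmW : m < W) (hmnW : m * n < W) (hin : HasInput E lam s)
    (hmatrix : ∀ j, s.ints MATRIX j = 0) (htouched : ∀ j, s.ints TOUCHED j = 0) :
    Runs W markEdges s (100 * (m + 1)) fun s' => StoresMatrix E G.edgeSet (s'.ints MATRIX) ∧
      (∀ v : Fin n, s'.ints TOUCHED v = 0 ↔ ∀ e, v ∉ E.edge e) ∧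
      ∀ e : Fin m, s'.ints EDGE e = 1 ∧ s'.ints START e = e * n := by
  refine (Runs.forLoop_wp (fun i s' => StoresMatrix E (E.firstEdges i) (s'.ints MATRIX) ∧
    (∀ v : Fin n, s'.ints TOUCHED v = 0 ↔ ∀ a ∈ E.firstEdges i, v ∉ a) ∧
    ∀ j < i, s'.ints EDGE j = 1 ∧ s'.ints START j = j * n) (C := 100) (by decide) hmW rfl
    (fun s' hF => by exact (hin.of_frame hF (by decide) rfl).m_eq) ?_ ?_).mono le_rfl ?_
  · simp only [E.firstEdges_zero]
    exact ⟨⟨by simp [hmatrix], by simp⟩, by simp [htouched], by simp⟩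
  · rintro i s' hi hF ⟨hA, hT, hS⟩ ha
    have hin' := hin.of_frame hF (by decide) rfl
    have hW : 1 < W := by omega
    lift i to Fin m using hi with e
    have hcell : e * n < W := (Nat.mul_le_mul_right n e.is_lt.le).trans_lt hmnW
    have hW' : (e : ℕ) + 1 < W := by omega
    simp only [enterEdge, touchEnds, Cmd.wp, IExp.eval, State.setI_ints, Nat.reduceEqDiff,
      reduceIte, ha, hin'.src, hin'.dst, hin'.n_eq, E.firstEdges_succ, hW, hW', hcell, true_and]
    refine ⟨hA.insert e, fun v => ?_, fun j hj => ?_⟩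
    · rw [Set.forall_mem_insert, ← hT, E.mem_edge]
      simp only [Function.update_apply, Fin.val_inj]
      grind
    · rcases Nat.lt_succ_iff_lt_or_eq.1 hj with hj | rfl
      · simpa [hj.ne] using hS j hj
      · simp
  · rintro s' ⟨hA, hT, hS⟩ -
    rw [E.firstEdges_self] at hA hT
    refine ⟨hA, fun v => (hT v).trans ?_, fun e => hS e e.is_lt⟩
    rw [← E.range_eq, Set.forall_mem_range]
    rfl

theorem runs_markVertices (hnW : n < W) (hin : HasInput E lam s) (hheight : s.ints HEIGHT 0 = 0)
    (htouched : ∀ v : Fin n, s.ints TOUCHED v = 0 ↔ ∀ e, v ∉ E.edge e) :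
    Runs W markVertices s (60 * (n + 1)) fun s' => (∀ v : Fin n, s'.ints VERT v = 1) ∧
      IsolatedStack E Finset.univ (s'.ints HEIGHT 0) (s'.ints STACK) := by
  refine (Runs.forLoop_wp (fun i s' => (∀ j < i, s'.ints VERT j = 1) ∧
    IsolatedStack E {v | v.val < i} (s'.ints HEIGHT 0) (s'.ints STACK)) (C := 60) (by decide) hnW
    rfl (fun s' hF => by exact (hin.of_frame hF (by decide) rfl).n_eq) ?_ ?_).mono le_rfl ?_
  · simp [hheight, IsolatedStack]
  · rintro i s' hi hF ⟨hV, hS⟩ ha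
    have hW : 1 < W := by omega
    lift i to Fin n using hi with v
    have hvW : (v : ℕ) < W := v.is_lt.trans hnW
    have hV' (j : ℕ) (hj : j < v + 1) : Function.update (s'.ints VERT) v 1 j = 1 := by
      rcases Nat.lt_succ_iff_lt_or_eq.1 hj with hj | rfl
      · rw [Function.update_of_ne hj.ne, hV j hj]
      · simp
    have hsucc : ({w : Fin n | w.val < v + 1} : Finset (Fin n)) =
        insert v ({w : Fin n | w.val < v} : Finset (Fin n)) := by
      ext w
      simp [le_iff_eq_or_lt, ← Fin.ext_iff]
    have hpush (hiso : ∀ e, v ∉ E.edge e) := hS.push (v := v) (by simp) hiso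
    simp only [Cmd.wp, IExp.eval, BExp.Holds, State.setI_ints, Nat.reduceEqDiff, reduceIte, ha, hW,
      hF.ints (a := TOUCHED) rfl, htouched, hsucc, true_and, Function.update_self, hvW]
    refine ⟨fun hiso => ⟨?_, hV', hpush hiso⟩, fun htouch => ⟨hV', ?_⟩⟩
    · exact (hpush hiso).le.trans_lt hnW
    · obtain ⟨e, he⟩ := not_forall_not.1 htouch
      exact hS.insert_of_mem he
  · rintro s' ⟨hV, hS⟩ -
    exact ⟨fun v => hV v v.is_lt, by simpa using hS⟩

theorem formsWedge_holds (hin : HasInput E lam s)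
    (hA : StoresMatrix E G.edgeSet (s.ints MATRIX)) {v x y : Fin n} (hv : s.ints INNER 0 = v)
    (hyx : G.Adj y x) {a b : IExp} (ha : a.eval s = x) (hb : b.eval s = y) :
    (formsWedge a b).Holds s ↔ IsWedge G y x v := by
  simp only [BExp.Holds, IExp.eval, ha, hb, hv, hin.n_eq, hA.eq_zero_iff, Fin.val_inj, IsWedge,
    hyx, not_not]
  tauto

theorem wp_append (hmW : m < W) (hnW : n < W) {k : Fin m → ℕ} {e f : Fin m} {v : Fin n}
    (h : StoresLists E k (s.ints LENGTH) (s.ints LIST)) (hk : ∀ e, k e ≤ n) (hv : k e = v)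
    (hf : ∀ g, WedgeAt E e v g ↔ g = f) (he : s.ints OUTER 0 = e) (hstart : s.ints START e = e * n)
    {x : IExp} (hx : (adjacency x).eval s = f + 1) {Q : State → Prop}
    (hQ : ∀ s', StoresLists E (Function.update k e (v + 1)) (s'.ints LENGTH) (s'.ints LIST) →
      Q s') : (append (var OUTER) x).wp W Q s := by
  have hlen := h.length_le e
  have hfW : (f : ℕ) < W := f.is_lt.trans hmW
  have hlenW : s.ints LENGTH e + 1 < W := by omega
  simp only [append, Cmd.wp, IExp.eval] at hx ⊢
  refine ⟨by simpa [hx], ?_⟩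
  simp only [hx, he, hstart, State.setI_ints, Nat.reduceEqDiff, reduceIte]
  exact ⟨hlenW, hQ _ (by simpa using h.append hk hv hf)⟩

theorem runs_buildList (hmW : m < W) (hnW : n < W) (hin : HasInput E lam s)
    (hA : StoresMatrix E G.edgeSet (s.ints MATRIX)) {e : Fin m} (he : s.ints OUTER 0 = e)
    (hstart : s.ints START e = e * n) {k : Fin m → ℕ} (hk : ∀ e, k e ≤ n) (hke : k e = 0)
    (h : StoresLists E k (s.ints LENGTH) (s.ints LIST)) :
    Runs W (buildList (var OUTER)) s (150 * (n + 1)) fun s' =>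
      StoresLists E (Function.update k e n) (s'.ints LENGTH) (s'.ints LIST) := by
  refine Runs.forLoop_wp (fun i s' =>
    StoresLists E (Function.update k e i) (s'.ints LENGTH) (s'.ints LIST)) (C := 150) (by decide)
    hnW rfl (fun s' hF => by exact (hin.of_frame hF (by decide) rfl).n_eq) ?_ ?_
  · simpa [← hke] using h
  · intro i s' hi hF hI ha
    have hin' := hin.of_frame hF (by decide) rfl
    rw [← hF.ints (a := MATRIX) rfl] at hA
    rw [← hF.ints (a := OUTER) rfl] at he
    rw [← hF.ints (a := START) rfl] at hstart
    lift i to Fin n using hi with v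
    have hkv : Function.update k e v e = v := Function.update_self ..
    have hkn (f : Fin m) : Function.update k e v f ≤ n := by
      rcases eq_or_ne f e with rfl | hfe
      · simp
      · simpa [hfe] using hk f
    have hsrc : (IExp.get SRC (var OUTER)).eval s' = E.src e := by simp [IExp.eval, he, hin'.src]
    have hdst : (IExp.get DST (var OUTER)).eval s' = E.dst e := by simp [IExp.eval, he, hin'.dst]
    have hadj : G.Adj (E.src e) (E.dst e) := E.edge_mem e
    simp only [Cmd.wp, formsWedge_holds hin' hA ha hadj.symm hsrc hdst,
      formsWedge_holds hin' hA ha hadj hdst hsrc]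
    refine ⟨fun hw => ?_, fun hw => ⟨fun hw' => ?_, fun hw' => ?_⟩⟩
    · obtain ⟨f, hf, hfe⟩ := hA.exists_eq_succ hw.2.1
      refine wp_append hmW hnW hI hkn hkv (f := f) (fun g => ?_) he hstart ?_ ?_
      · rw [wedgeAt_iff_of_isWedge_src hw, ← hfe, E.edge_injective.eq_iff]
      · simpa only [IExp.eval, ha, he, hin'.n_eq, hin'.src]
      · simp
    · obtain ⟨f, hf, hfe⟩ := hA.exists_eq_succ hw'.2.1
      refine wp_append hmW hnW hI hkn hkv (f := f) (fun g => ?_) he hstart ?_ ?_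
      · rw [wedgeAt_iff_of_isWedge_dst hw', ← hfe, E.edge_injective.eq_iff]
      · simpa only [IExp.eval, ha, he, hin'.n_eq, hin'.dst]
      · simp
    · simpa using hI.skip hkv fun f hf => hf.elim (fun hf => hw hf.1) fun hf => hw' hf.1

theorem runs_buildLists (hmW : m < W) (hnW : n < W) (hin : HasInput E lam s)
    (hA : StoresMatrix E G.edgeSet (s.ints MATRIX)) (hstart : ∀ e : Fin m, s.ints START e = e * n)
    (hlen : ∀ e : Fin m, s.ints LENGTH e = 0) :
    Runs W buildLists s ((150 * (n + 1) + 20) * (m + 1)) fun s' =>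
      StoresLists E (fun _ => n) (s'.ints LENGTH) (s'.ints LIST) := by
  refine (Runs.forLoop_const (fun i s' => StoresLists E (fun e => if e < i then n else 0)
    (s'.ints LENGTH) (s'.ints LIST)) (T := 150 * (n + 1)) (C := 150 * (n + 1) + 20)
    (by simp only [IExp.cost]; omega) hmW rfl
    (fun s' hF => by exact (hin.of_frame hF (by decide) rfl).m_eq) ?_ ?_).mono le_rfl ?_
  · simpa using StoresLists.empty hlen
  · intro i s' hi hF hI ha
    rw [← hF.ints (a := MATRIX) rfl] at hA
    rw [← hF.ints (a := START) rfl] at hstart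
    lift i to Fin m using hi with e
    refine (runs_buildList hmW hnW (hin.of_frame hF (by decide) rfl) hA ha (hstart e)
      (fun f => ?_) (by simp) hI).mono le_rfl fun s'' h _ => ?_
    · split_ifs <;> omega
    · have hsucc : Function.update (fun f : Fin m => if f.val < e then n else 0) e n =
          fun f : Fin m => if f.val < e + 1 then n else 0 := by
        ext f
        simp only [Function.update_apply, Nat.lt_succ_iff_lt_or_eq, Fin.val_inj]
        grind
      simpa only [State.setI_ints, Nat.reduceEqDiff, reduceIte, ← hsucc] using h
  · exact fun s' h _ => by simpa using h

theorem StoresLists.storesGraph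
    (h : StoresLists E (fun _ => n) (s.ints LENGTH) (s.ints LIST)) (hin : HasInput E lam s)
    (hstart : ∀ e : Fin m, s.ints START e = e * n)
    (hedge : ∀ e : Fin m, s.ints EDGE e = 1) : StoresGraph E lam Finset.univ s where
  toHasInput := hin
  edges e := by simp [hedge]
  length_le := h.length_le
  entry_lt e j hj := by
    obtain ⟨f, -, hf⟩ := (h.image_eq e).le ⟨j, hj, rfl⟩
    exact hstart e ▸ hf.symm.trans_lt f.is_lt
  adj_iff e f := by
    have hmem := Set.ext_iff.1 (h.image_eq e) f
    simp only [Set.mem_image, Set.mem_Iio, Set.mem_ofPred_eq, Fin.val_inj, exists_eq_right,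
      Fin.is_lt, true_and] at hmem
    rw [wedgeGraph_adj_iff_wedgeAt, hstart, hmem]

theorem runs_loadGraph (hmW : m < W) (hnW : n < W) (hmnW : m * n < W) (E : EdgeList G m) (lam : ℝ) :
    Runs W loadGraph (inputState E lam) (330 * ((m + 1) * (n + 1))) fun s =>
      StoresGraph E lam Finset.univ s ∧ (∀ v : Fin n, s.ints VERT v = 1) ∧
      IsolatedStack E Finset.univ (s.ints HEIGHT 0) (s.ints STACK) := by
  have hin : HasInput E lam (inputState E lam) := by constructor <;> simp [inputState]
  refine ((runs_markEdges hmW hmnW hin (by simp [inputState]) (by simp [inputState])).seq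
    (T' := 60 * (n + 1) + (150 * (n + 1) + 20) * (m + 1))
    fun s₁ ⟨hA, htouched, hedge⟩ hF₁ => ?_).mono_time (by ring_nf; omega)
  have hin₁ := hin.of_frame hF₁ (by decide) rfl
  have hheight : s₁.ints HEIGHT 0 = 0 := by rw [hF₁.ints rfl]; simp [inputState]
  refine (runs_markVertices hnW hin₁ hheight htouched).seq fun s₂ ⟨hvert, hstack⟩ hF₂ => ?_
  have hin₂ := hin₁.of_frame hF₂ (by decide) rfl
  rw [← hF₂.ints (a := MATRIX) rfl] at hA
  simp only [← hF₂.ints (a := EDGE) rfl, ← hF₂.ints (a := START) rfl, forall_and] at hedge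
  have hlen (e : Fin m) : s₂.ints LENGTH e = 0 := by
    rw [hF₂.ints rfl, hF₁.ints rfl]
    simp [inputState]
  refine (runs_buildLists hmW hnW hin₂ hA hedge.2 hlen).mono le_rfl fun s₃ h hF₃ => ?_
  simp only [← hF₃.ints (a := EDGE) rfl, ← hF₃.ints (a := START) rfl] at hedge
  rw [← hF₃.ints (a := VERT) rfl] at hvert
  rw [← hF₃.ints (a := HEIGHT) rfl, ← hF₃.ints (a := STACK) rfl] at hstack
  exact ⟨h.storesGraph (hin₂.of_frame hF₃ (by decide) rfl) hedge.2 hedge.1, hvert, hstack⟩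

theorem remembers_empty (hF : Frame init (inputState E lam) s) : Remembers E lam ∅ ∅ s where
  card := by rw [hF.ints rfl]; simp [inputState]
  total := by rw [hF.reals rfl]; simp [inputState, totalWeight_empty]
  weak e he := by simp [weakEdges, Covered] at he
  strong e _ := by rw [hF.ints rfl]; simp [inputState]

theorem runs_init (hmW : m < W) (hnW : n < W) (hmnW : m * n < W) (E : EdgeList G m) (lam : ℝ) :
    Runs W init (inputState E lam) (620 * ((m + 1) * (n + 1))) fun s =>
      ∃ M, AprMatching (wedgeGraph G) M ∧ Maintains E lam Finset.univ M s ∧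
        IsolatedStack E Finset.univ (s.ints HEIGHT 0) (s.ints STACK) ∧ Remembers E lam ∅ ∅ s := by
  suffices h : Runs W init (inputState E lam) (620 * ((m + 1) * (n + 1))) fun s =>
      ∃ M, AprMatching (wedgeGraph G) M ∧ Maintains E lam Finset.univ M s ∧
        IsolatedStack E Finset.univ (s.ints HEIGHT 0) (s.ints STACK) from
    h.mono le_rfl fun s ⟨M, hM, h, hstack⟩ hF => ⟨M, hM, h, hstack, remembers_empty hF⟩
  refine ((runs_loadGraph hmW hnW hmnW E lam).seq (T' := 280 * ((m + 1) * (n + 1)) + 10)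
    fun s₁ ⟨hG₁, hvert, hstack⟩ hF₁ => ?_).mono_time (by ring_nf; omega)
  refine ((runs_initMatching hmW hnW hG₁ fun e => by rw [hF₁.ints rfl]; simp [inputState]).seq
    (T' := 4 + 140 * (m + 1)) fun s₂ ⟨M, hM, hpartner⟩ hF₂ => ?_).mono_time (by ring_nf; omega)
  have hG₂ := hG₁.of_frame hF₂ (by decide) rfl
  have hassign : Runs W (assign COUNT nVar) s₂ 4 fun s' => s'.ints COUNT 0 = n :=
    .of_wp (by simp [Cmd.wp, IExp.eval, hG₂.n_eq, hnW])
  refine hassign.seq fun s₃ hcount hF₃ => ?_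
  have hG₃ := hG₂.of_frame hF₃ (by decide) rfl
  rw [← hF₃.ints (a := PARTNER) rfl] at hpartner
  refine (runs_computePriorities hmW hG₃ hpartner fun v _ => ?_).mono le_rfl
    fun s₄ ⟨hprio, htotal⟩ hF₄ => ⟨M, hM, ?_, ?_⟩
  · rw [hF₃.reals rfl, hF₂.reals rfl, hF₁.reals rfl]
    simp [inputState]
  · refine ⟨hG₃.of_frame hF₄ (by decide) rfl, ?_, fun v => ?_, ?_, hprio, htotal⟩
    · rw [hF₄.ints rfl, hcount, Finset.card_fin]
    · rw [hF₄.ints rfl, hF₃.ints rfl, hF₂.ints rfl, hvert, if_pos (Finset.mem_univ v)]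
    · rwa [hF₄.ints rfl]
  · have hstack_eq (a : ℕ) (ha : a = HEIGHT ∨ a = STACK) : s₄.ints a = s₁.ints a := by
      rcases ha with rfl | rfl <;> rw [hF₄.ints rfl, hF₃.ints rfl, hF₂.ints rfl]
    rwa [hstack_eq _ (.inl rfl), hstack_eq _ (.inr rfl)]

theorem runs_fin (hnW : n < W) (hn : s.ints SIZE 0 = n) :
    Runs W fin s (40 * (n + 1)) fun s' =>
      ∀ v < n, s'.ints OUT v = if s.ints TIME v ≤ s.ints BESTCARD 0 then 1 else 0 := by
  refine Runs.forLoop_wp (fun i s' => ∀ v < i, s'.ints OUT v =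
    if s.ints TIME v ≤ s.ints BESTCARD 0 then 1 else 0) (C := 40) (by decide) hnW rfl
    (fun s' hF => by simpa only [IExp.eval, hF.ints (a := SIZE) rfl]) (by simp) ?_
  intro i s' hi hF hI ha
  have hW : 1 < W := by omega
  have hupdate (x : ℕ) (hx : x = if s.ints TIME i ≤ s.ints BESTCARD 0 then 1 else 0) (v : ℕ)
      (hv : v < i + 1) : Function.update (s'.ints OUT) i x v =
        if s.ints TIME v ≤ s.ints BESTCARD 0 then 1 else 0 := by
    rcases Nat.lt_succ_iff_lt_or_eq.1 hv with hv | rfl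
    · rw [Function.update_of_ne hv.ne, hI v hv]
    · rw [Function.update_self, hx]
  simp only [Cmd.wp, IExp.eval, BExp.Holds, State.setI_ints, Nat.reduceEqDiff, reduceIte, ha, hW,
    hF.ints (a := TIME) rfl, hF.ints (a := BESTCARD) rfl]
  exact ⟨fun h => ⟨by omega, hupdate 0 (if_neg h.not_ge).symm⟩,
    fun h => ⟨trivial, hupdate 1 (if_pos (not_lt.1 h)).symm⟩⟩

end Initialization

end STC

/-! ## The run of the program -/

theorem RAM.exec_loop {W N : ℕ} {b : BExp} {p : Cmd} {σ : ℕ → State} {T : ℕ → ℕ}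
    (hp : ∀ i < N, ∃ t ≤ T i, Exec W p (σ i) (σ (i + 1)) t) (hb : ∀ i < N, b.Holds (σ i))
    (hN : ¬ b.Holds (σ N)) : ∃ t ≤ ∑ i ∈ Finset.range N, (b.cost + 1 + T i) + (b.cost + 1),
      Exec W (.loop b p) (σ 0) (σ N) t := by
  induction N generalizing σ T with
  | zero => exact ⟨_, by simp, .loopFalse b p _ hN⟩
  | succ N ih =>
    obtain ⟨t, ht, hpass⟩ := hp 0 N.succ_pos
    obtain ⟨t', ht', hloop⟩ := ih (σ := fun i => σ (i + 1)) (T := fun i => T (i + 1))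
      (fun i hi => hp (i + 1) (Nat.succ_lt_succ hi)) (fun i hi => hb (i + 1) (Nat.succ_lt_succ hi))
      hN
    refine ⟨_, ?_, .loopTrue b p _ _ _ _ _ (hb 0 N.succ_pos) hpass hloop⟩
    rw [Finset.sum_range_succ']
    omega

namespace STC

open RAM

theorem exists_seq_of_step {X : Type*} {P : ℕ → X → Prop} {R : X → X → Prop} {N : ℕ} {x₀ : X}
    (h₀ : P 0 x₀) (hstep : ∀ i < N, ∀ x, P i x → ∃ y, P (i + 1) y ∧ R x y) :
    ∃ f : ℕ → X, f 0 = x₀ ∧ (∀ i ≤ N, P i (f i)) ∧ ∀ i < N, R (f i) (f (i + 1)) := by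
  have hnext (i x) : ∃ y, i < N → P i x → P (i + 1) y ∧ R x y := by
    by_cases h : i < N ∧ P i x
    · obtain ⟨y, hy⟩ := hstep i h.1 x h.2
      exact ⟨y, fun _ _ => hy⟩
    · exact ⟨x, fun hi hx => absurd ⟨hi, hx⟩ h⟩
  choose next hnext using hnext
  let f : ℕ → X := fun i => Nat.rec x₀ next i
  have hP (i : ℕ) (hi : i ≤ N) : P i (f i) := by
    induction i with
    | zero => exact h₀
    | succ i ih => exact (hnext i (f i) hi (ih (by omega))).1
  exact ⟨f, rfl, hP, fun i hi => (hnext i (f i) hi (hP i hi.le)).2⟩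

section EdgeList

variable {n m : ℕ} {G : SimpleGraph (Fin n)}

theorem EdgeList.le_mul_self (E : EdgeList G m) : m ≤ n * n := by
  have hinj : Function.Injective fun e => (E.src e, E.dst e) :=
    .of_comp (f := fun p : Fin n × Fin n => s(p.1, p.2)) E.injective
  simpa using Fintype.card_le_of_injective _ hinj

theorem EdgeList.sum_degree (E : EdgeList G m) : ∑ v, Finset.card {e | v ∈ E.edge e} = 2 * m := by
  have hedge (e : Fin m) : Finset.card {v | v ∈ E.edge e} = 2 := by
    have hends : ({v | v ∈ E.edge e} : Finset (Fin n)) = {E.src e, E.dst e} := by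
      ext v
      simp [E.mem_edge]
    rw [hends, Finset.card_pair (E.src_ne_dst e)]
  calc ∑ v, Finset.card {e | v ∈ E.edge e}
      = ∑ e, Finset.card {v | v ∈ E.edge e} :=
        Finset.sum_card_bipartiteAbove_eq_sum_card_bipartiteBelow fun v e => v ∈ E.edge e
    _ = 2 * m := by simp [hedge, mul_comm]

end EdgeList

section Recorded

variable {n m : ℕ} {G : SimpleGraph (Fin n)} {E : EdgeList G m} {lam : ℝ}
  {U U' : Finset (Fin n)} {M M' : Set (Sym2 (Sym2 (Fin n)))} {s s' : State}

theorem Recorded.of_empty (h : Recorded E lam U M s s') (hs : Remembers E lam ∅ ∅ s) :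
    Remembers E lam U M s' := by
  simpa [totalWeight_empty] using h ∅ ∅ hs

theorem Recorded.remembers_max (h : Recorded E lam U M s s') (hU : U.Nonempty) (hU' : U'.Nonempty)
    (hs : Remembers E lam U' M' s) :
    (Remembers E lam U' M' s' ∧
      score G lam U (weakEdges M) ≤ score G lam U' (weakEdges M')) ∨
    (Remembers E lam U M s' ∧ score G lam U' (weakEdges M') ≤ score G lam U (weakEdges M)) := by
  have hcard : (0 : ℝ) < U.card := by exact_mod_cast hU.card_pos
  have hcard' : (0 : ℝ) < U'.card := by exact_mod_cast hU'.card_pos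
  have hrec := h U' M' hs
  split_ifs at hrec with hlt
  · exact .inl ⟨hrec, (div_le_div_iff₀ hcard hcard').2 hlt.le⟩
  · exact .inr ⟨hrec, (div_le_div_iff₀ hcard' hcard).2 (not_lt.1 hlt)⟩

end Recorded

/-- A stage of an execution of the program, before or after a pass of the main loop: the vertex set,
the matching, the memory and the vertex deleted last (any vertex at the first stage). -/
structure Stage (n : ℕ) where
  U : Finset (Fin n)
  M : Set (Sym2 (Sym2 (Fin n)))
  s : State
  u : Fin n

/-- The score of the vertex set of a stage with the labeling given by its matching. -/
noncomputable abbrev Stage.score {n : ℕ} (G : SimpleGraph (Fin n)) (lam : ℝ) (x : Stage n) : ℝ :=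
  STC.score G lam x.U (weakEdges x.M)

section Execution

variable {n m W : ℕ} {G : SimpleGraph (Fin n)} (E : EdgeList G m) (lam : ℝ)

/-- The invariant of the main loop after `i` passes. -/
structure Stage.Valid (i : ℕ) (x : Stage n) : Prop where
  maintains : Maintains E lam x.U x.M x.s
  isolated : IsolatedStack E x.U (x.s.ints HEIGHT 0) (x.s.ints STACK)
  maximal : IsMaximalMatching (wedgeGraph (restrict G x.U)) x.M
  card_add : x.U.card + i = n

/-- A pass of the main loop leads from `x` to `y`. -/
structure Stage.Pass (W : ℕ) (x y : Stage n) : Prop where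
  mem : y.u ∈ x.U
  argmin : ∀ v ∈ x.U, priorities G lam x.U x.M y.u ≤ priorities G lam x.U x.M v
  delete : y.U = x.U.erase y.u
  relabel : DynamicVertexCover (wedgeGraph (restrict G y.U))
    ((restrict G x.U).incidenceSet y.u) x.M y.M
  exec : ∃ t ≤ 560 * (m + 1) + Finset.card {e | y.u ∈ E.edge e} * (100 * (n + 1)),
    Exec W body x.s y.s t
  recorded : Recorded E lam x.U x.M x.s y.s
  time : y.s.ints TIME = Function.update (x.s.ints TIME) y.u x.U.card

/-- The stages of an execution of the initialization and the main loop. -/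
structure IsTrace (W : ℕ) (x : ℕ → Stage n) : Prop where
  start_vertices : (x 0).U = Finset.univ
  start_matching : AprMatching (wedgeGraph G) (x 0).M
  start_remembers : Remembers E lam ∅ ∅ (x 0).s
  start_exec : ∃ t ≤ 620 * ((m + 1) * (n + 1)), Exec W init (inputState E lam) (x 0).s t
  valid : ∀ i ≤ n, (x i).Valid E lam i
  pass : ∀ i < n, (x i).Pass E lam W (x (i + 1))

variable {E lam}

theorem Stage.Valid.exists_pass (hmW : m < W) (hnW : n < W) {i : ℕ} (hi : i < n) {x : Stage n}
    (h : x.Valid E lam i) : ∃ y : Stage n, y.Valid E lam (i + 1) ∧ x.Pass E lam W y := by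
  have hcard := h.card_add
  have hne : x.U.Nonempty := Finset.card_pos.1 (by omega)
  obtain ⟨u, hu, hmin, s', t, he, ht, hrec, htime, hstack, M', hdyn, hmaintains⟩ :=
    runs_body hmW hnW (by omega) h.maintains h.isolated h.maximal.1 hne
  refine ⟨⟨x.U.erase u, M', s', u⟩, ⟨hmaintains, hstack, ?_, ?_⟩,
    ⟨hu, hmin, rfl, hdyn, ⟨t, ht, he⟩, hrec, htime⟩⟩
  · exact hdyn.isMaximalMatching (isDeletion_wedgeGraph_erase G x.U u) h.maximal
  · simp only [Finset.card_erase_of_mem hu]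
    omega

theorem exists_isTrace (hm : 1 ≤ m) (hmW : m < W) (hnW : n < W) (hmnW : m * n < W)
    (E : EdgeList G m) (lam : ℝ) : ∃ x, IsTrace E lam W x := by
  obtain ⟨s, t, he, ht, M, hM, hmaintains, hstack, hremembers⟩ := runs_init hmW hnW hmnW E lam
  obtain ⟨x, hx, hvalid, hpass⟩ := exists_seq_of_step (P := Stage.Valid E lam)
    (R := Stage.Pass E lam W) (x₀ := ⟨Finset.univ, M, s, E.src ⟨0, hm⟩⟩)
    ⟨hmaintains, hstack, by rw [restrict_univ]; exact hM.isMaximalMatching, by simp⟩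
    fun i hi y hy => hy.exists_pass hmW hnW hi
  exact ⟨x, by rw [hx], by rwa [hx], by rwa [hx], by rw [hx]; exact ⟨t, ht, he⟩, hvalid, hpass⟩

namespace IsTrace

variable {x : ℕ → Stage n} {i j : ℕ}

theorem greedyRun (h : IsTrace E lam W x) :
    GreedyRun G lam (fun i => (x i).U) (fun i => (x i).M) fun i => (x (i + 1)).u where
  start_vertices := h.start_vertices
  start_matching := h.start_matching
  mem i hi := (h.pass i (by simpa using hi)).mem
  argmin i hi := (h.pass i (by simpa using hi)).argmin
  delete i hi := (h.pass i (by simpa using hi)).delete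
  relabel i hi := (h.pass i (by simpa using hi)).relabel

theorem nonempty (h : IsTrace E lam W x) (hi : i < n) : (x i).U.Nonempty :=
  ⟨_, (h.pass i hi).mem⟩

theorem subset (h : IsTrace E lam W x) (hij : i ≤ j) (hj : j ≤ n) : (x j).U ⊆ (x i).U := by
  induction j, hij using Nat.le_induction with
  | base => exact subset_rfl
  | succ j _ ih =>
    rw [(h.pass j hj).delete]
    exact (Finset.erase_subset _ _).trans (ih (by omega))

theorem eq_empty (h : IsTrace E lam W x) : (x n).U = ∅ :=
  Finset.card_eq_zero.1 (by simpa using (h.valid n le_rfl).card_add)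

theorem exists_time_eq (h : IsTrace E lam W x) (hi : i ≤ n) {v : Fin n} (hv : v ∉ (x i).U) :
    ∃ k < i, v ∈ (x k).U ∧ v ∉ (x (k + 1)).U ∧ (x i).s.ints TIME v = (x k).U.card := by
  induction i with
  | zero => simp [h.start_vertices] at hv
  | succ i ih =>
    have hpass := h.pass i hi
    by_cases hvi : v ∈ (x i).U
    · have hvu : v = (x (i + 1)).u := by
        rw [hpass.delete, Finset.mem_erase] at hv
        tauto
      refine ⟨i, i.lt_succ_self, hvi, hv, ?_⟩
      rw [hpass.time, ← hvu, Function.update_self]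
    · obtain ⟨k, hk, hvk, hvk', htime⟩ := ih (by omega) hvi
      refine ⟨k, by omega, hvk, hvk', ?_⟩
      have hvu : (v : ℕ) ≠ (x (i + 1)).u := fun hvu => hvi (Fin.ext hvu ▸ hpass.mem)
      rw [hpass.time, Function.update_of_ne hvu, htime]

theorem time_le_card_iff (h : IsTrace E lam W x) (hi : i ≤ n) (v : Fin n) :
    (x n).s.ints TIME v ≤ (x i).U.card ↔ v ∈ (x i).U := by
  obtain ⟨k, hk, hvk, hvk', htime⟩ := h.exists_time_eq le_rfl (v := v) (by simp [h.eq_empty])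
  have hcard := (h.valid i hi).card_add
  have hcardk := (h.valid k hk.le).card_add
  have hmem : v ∈ (x i).U ↔ i ≤ k := by
    refine ⟨fun hvi => ?_, fun hik => h.subset hik hk.le hvk⟩
    by_contra! hki
    exact hvk' (h.subset hki hi hvi)
  rw [htime, hmem]
  omega

theorem exists_remembers_max (h : IsTrace E lam W x) (hi : 1 ≤ i) (hin : i ≤ n) :
    ∃ j < i, Remembers E lam (x j).U (x j).M (x i).s ∧
      ∀ k < i, (x k).score G lam ≤ (x j).score G lam := by
  induction i, hi using Nat.le_induction with
  | base => exact ⟨0, one_pos, (h.pass 0 hin).recorded.of_empty h.start_remembers, by simp⟩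
  | succ i _ ih =>
    obtain ⟨j, hj, hrem, hmax⟩ := ih (by omega)
    obtain ⟨hrem', hle⟩ | ⟨hrem', hle⟩ :=
      (h.pass i hin).recorded.remembers_max (h.nonempty hin) (h.nonempty (by omega)) hrem
    · exact ⟨j, by omega, hrem', fun k hk => (Nat.lt_succ_iff_lt_or_eq.1 hk).elim (hmax k)
        fun hk => hk ▸ hle⟩
    · exact ⟨i, i.lt_succ_self, hrem', fun k hk => (Nat.lt_succ_iff_lt_or_eq.1 hk).elim
        (fun hk => (hmax k hk).trans hle) fun hk => hk ▸ le_rfl⟩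

theorem sum_deleted (h : IsTrace E lam W x) (f : Fin n → ℕ) :
    ∑ i ∈ Finset.range n, f (x (i + 1)).u = ∑ v, f v := by
  have hsum (k : ℕ) (hk : k ≤ n) :
      ∑ i ∈ Finset.range k, f (x (i + 1)).u + ∑ v ∈ (x k).U, f v = ∑ v, f v := by
    induction k with
    | zero => simp [h.start_vertices]
    | succ k ih =>
      rw [Finset.sum_range_succ, ← ih (by omega), (h.pass k hk).delete, add_assoc,
        Finset.add_sum_erase _ _ (h.pass k hk).mem]
  simpa [h.eq_empty] using hsum n le_rfl

theorem exec_loop (h : IsTrace E lam W x) :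
    ∃ t ≤ n * (560 * (m + 1) + 5) + 2 * m * (100 * (n + 1)) + 5,
      Exec W (.loop (.ilt (.const 0) (var COUNT)) body) (x 0).s (x n).s t := by
  have hcount (i : ℕ) (hi : i ≤ n) : (x i).s.ints COUNT 0 = n - i := by
    have hcard := (h.valid i hi).card_add
    rw [(h.valid i hi).maintains.count]
    omega
  obtain ⟨t, ht, he⟩ := RAM.exec_loop (b := .ilt (.const 0) (var COUNT))
    (σ := fun i => (x i).s) (fun i hi => (h.pass i hi).exec)
    (fun i hi => by simpa [BExp.Holds, IExp.eval, hcount i hi.le])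
    (by simp [BExp.Holds, IExp.eval, hcount n le_rfl])
  refine ⟨t, ht.trans_eq ?_, he⟩
  have hdegree := (h.sum_deleted fun v => Finset.card {e | v ∈ E.edge e}).trans E.sum_degree
  simp only [Finset.sum_add_distrib, ← Finset.sum_mul, hdegree, Finset.sum_const,
    Finset.card_range, smul_eq_mul, BExp.cost, IExp.cost]
  ring

theorem carriesOutGreedy (h : IsTrace E lam W x) (hnW : n < W) (hm : 1 ≤ m) :
    ∃ T ≤ 5000 * (m * n), CarriesOutGreedy W init body fin E lam T := by
  have hn : 1 ≤ n := (E.src ⟨0, hm⟩).pos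
  obtain ⟨t₀, ht₀, hinit⟩ := h.start_exec
  obtain ⟨t₁, ht₁, hloop⟩ := h.exec_loop
  obtain ⟨out, t₂, hfin, ht₂, hout⟩ :=
    runs_fin hnW (h.valid n le_rfl).maintains.toHasInput.n_eq
  obtain ⟨j, hj, hrem, hmax⟩ := h.exists_remembers_max hn le_rfl
  refine ⟨t₀ + (t₁ + t₂), ?_, _, _, _, fun i => (x i).s, out, h.greedyRun, ⟨t₀, hinit⟩,
    fun i hi => (h.pass i hi).exec.imp fun t ht => ht.2,
    fun i hi => (h.valid i hi).maintains.represents,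
    .seq _ _ _ _ _ _ _ hinit (.seq _ _ _ _ _ _ _ hloop hfin), j, hj, hmax,
    fun v => ?_, fun e _ _ => ?_⟩
  · nlinarith [Nat.mul_le_mul hm hn]
  · simp only [hout v v.is_lt, hrem.card, h.time_le_card_iff hj.le]
  · rw [hfin.frame.ints rfl]
    exact ⟨hrem.weak e, hrem.strong e⟩

end IsTrace

end Execution

theorem exists_carriesOutGreedy {n m : ℕ} {G : SimpleGraph (Fin n)} (E : EdgeList G m) (lam : ℝ)
    (hm : 1 ≤ m) :
    ∃ T ≤ 5000 * (m * n), CarriesOutGreedy ((n + 2) ^ 3) init body fin E lam T := by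
  have hn : 1 ≤ n := (E.src ⟨0, hm⟩).pos
  have hmnW : m * n < (n + 2) ^ 3 := by nlinarith [Nat.mul_le_mul_right n E.le_mul_self]
  have hmW : m < (n + 2) ^ 3 := (Nat.le_mul_of_pos_right m hn).trans_lt hmnW
  have hnW : n < (n + 2) ^ 3 := (Nat.le_mul_of_pos_left n hm).trans_lt hmnW
  obtain ⟨x, hx⟩ := exists_isTrace hm hmW hnW hmnW E lam
  exact hx.carriesOutGreedy hnW hm

end STC

theorem mainTheorem9_general :
    (∃ (init body fin : RAM.Cmd) (c : ℕ) (C : ℝ),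
      ∀ (n m : ℕ) (G : SimpleGraph (Fin n)) (E : STC.EdgeList G m) (lam : ℝ), 1 ≤ m →
        ∃ T : ℕ, STC.CarriesOutGreedy ((n + 2) ^ c) init body fin E lam T ∧
          (T : ℝ) ≤ C * STC.greedyBound G m) ∧
    (∃ C : ℝ, ∀ (n m : ℕ) (G : SimpleGraph (Fin n)), G.edgeSet.ncard = m →
      STC.greedyBound G m ≤ C * ((n : ℝ) * m)) ∧
    (∀ (V : Type*) [Fintype V] [DecidableEq V] (G : SimpleGraph V) (lam : ℝ) (U : ℕ → Finset V)
      (M : ℕ → Set (Sym2 (Sym2 V))) (u : ℕ → V), STC.GreedyRun G lam U M u →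
        ∀ i ≤ Fintype.card V,
          STC.IsMaximalMatching (STC.wedgeGraph (STC.restrict G (U i))) (M i)) := by
  refine ⟨⟨STC.init, STC.body, STC.fin, 3, 5000, fun n m G E lam hm => ?_⟩,
    ⟨6, fun n m G hm => STC.greedyBound_le G hm⟩,
    fun V _ _ G lam U M u h i hi => h.isMaximalMatching hi⟩
  obtain ⟨T, hT, hgreedy⟩ := STC.exists_carriesOutGreedy E lam hm
  refine ⟨T, hgreedy, ?_⟩
  calc (T : ℝ) ≤ 5000 * ((n : ℝ) * m) := by exact_mod_cast mul_comm m n ▸ hT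
    _ ≤ 5000 * STC.greedyBound G m := by gcongr; exact STC.mul_le_greedyBound G m

theorem mainTheorem9 :
    -- some implementation of Greedy has a running time in O(mn + (n' + m') + m log n + nm)
    (∃ (init body fin : RAM.Cmd) (c : ℕ) (C : ℝ),
      ∀ (n m : ℕ) (G : SimpleGraph (Fin n)) (E : STC.EdgeList G m) (lam : ℝ),
        1 ≤ m → 0 ≤ lam → lam ≤ 1 →
        ∃ T : ℕ, STC.CarriesOutGreedy ((n + 2) ^ c) init body fin E lam T ∧
          (T : ℝ) ≤ C * STC.greedyBound G m) ∧
    -- and this class is contained in O(nm)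
    (∃ C : ℝ, ∀ (n m : ℕ) (G : SimpleGraph (Fin n)), G.edgeSet.ncard = m →
      STC.greedyBound G m ≤ C * ((n : ℝ) * m)) ∧
    -- every run of Greedy maintains a maximal matching of the wedge graph
    (∀ (n : ℕ) (G : SimpleGraph (Fin n)) (lam : ℝ) (U : ℕ → Finset (Fin n))
      (M : ℕ → Set (Sym2 (Sym2 (Fin n)))) (u : ℕ → Fin n), STC.GreedyRun G lam U M u →
        ∀ i ≤ n, STC.IsMaximalMatching (STC.wedgeGraph (STC.restrict G (U i))) (M i)) := by
  obtain ⟨⟨init, body, fin, c, C, himpl⟩, hbound, hmaximal⟩ := mainTheorem9_general.{0}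
  exact ⟨⟨init, body, fin, c, C, fun n m G E lam hm _ _ => himpl n m G E lam hm⟩, hbound,
    fun n G lam U M u h i hi => hmaximal (Fin n) G lam U M u h i (by simpa using hi)⟩
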